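/- Let $k$ be an algebraically closed field of characteristic zero, $G$ a finite group and $\alpha:G^3\to k^*$ a normalised 3-cocycle, i.e. $\alpha(g,h,l)\,\alpha(f,gh,l)\,\alpha(f,g,h)=\alpha(fg,h,l)\,\alpha(f,g,hl)$ and $\alpha(f,g,h)=1$ whenever one of $f,g,h$ is $1$. Write ${}^fg=fgf^{-1}$ and put $$\alpha(f,g|h)=\alpha(f,g,h)^{-1}\,\alpha(f,{}^gh,g)\,\alpha({}^{fg}h,f,g)^{-1},\qquad \alpha(f|g,h)=\alpha(f,g,h)\,\alpha({}^fg,f,h)^{-1}\,\alpha({}^fg,{}^fh,f).$$ The twisted Drinfeld centre $\mathcal Z(G,\alpha)$ is the following braided monoidal category. Its objects are the finite-dimensional $G$-graded $k$-vector spaces $X=\bigoplus_g X_g$ with automorphisms $x\mapsto f.x$ $(f\in G)$ such that $f.X_g=X_{{}^fg}$ and $(fg).x=\alpha(f,g|h)\,f.(g.x)$ for $x\in X_h$; its morphisms are the linear maps preserving grading and action. The tensor product is that of graded vector spaces, with $f.(x\otimes y)=\alpha(f|g,h)\,(f.x\otimes f.y)$ for $x\in X_g$, $y\in Y_h$; the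 unit is $k$ in degree $1$ with trivial action; the associativity constraint is $x\otimes(y\otimes z)\mapsto\alpha(f,g,h)\,(x\otimes y)\otimes z$ for $x\in X_f$, $y\in Y_g$, $z\in Z_h$; the braiding is $c(x\otimes y)=f.y\otimes x$ for $x\in X_f$. A Lagrangian algebra in $\mathcal Z(G,\alpha)$ is a nonzero commutative (associative, unital) algebra $L$ such that every local right $L$-module is a (finite) direct sum of copies of the regular module $L$; a (unital) right module $\nu:M\otimes L\to M$ is local if $\nu\, c_{L,M}\,c_{M,L}=\nu$. Let $H\subset G$ be a subgroup and let $\gamma:H\times H\to k^*$ be a normalised 2-cochain with $d\gamma=\alpha|_H$, i.e. $\gamma(g,h)\,\gamma(fg,h)^{-1}\,\gamma(f,gh)\,\gamma(f,g)^{-1}=\alpha(f,g,h)$ for $f,g,h\in H$. Let $k[H,\gamma]$ be the algebra in $\mathcal Z(H,\alpha|_H)$ with basis $e_h$ in degree $h\in H$, product $e_fe_g=\gamma(f,g)e_{fg}$ and action $f.e_g=\gamma(f,g)\,\gamma({}^fg,f)^{-1}e_{{}^fg}$. For an algebra $B$ in $\mathcal Z(H,\alpha|_H)$ let $E(B)$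 be the algebra in $\mathcal Z(G,\alpha)$ whose component of degree $f\in G$ consists of the maps $a:G\to B$ with $a(x)\in B_{x^{-1}fx}$ (where $B_g=0$ for $g\notin H$) and $a(xh)=\alpha(h^{-1},x^{-1}|f)\,h^{-1}.a(x)$ for all $x\in G$, $h\in H$, with action $(g.a)(x)=\alpha(x^{-1},g|f)^{-1}a(g^{-1}x)$ for $a$ of degree $f$, product $(ab)(x)=\alpha(x^{-1}|f,g)\,a(x)b(x)$ for $a,b$ of degrees $f,g$, and unit the constant map $x\mapsto 1_B$. Put $L(H,\gamma)=E(k[H,\gamma])$. Then every Lagrangian algebra in $\mathcal Z(G,\alpha)$ is isomorphic, as an algebra in $\mathcal Z(G,\alpha)$, to $L(H,\gamma)$ for some subgroup $H\subset G$ and some normalised $\gamma\in C^2(H,k^*)$ with $d\gamma=\alpha|_H$. -/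

import Mathlib

universe u

noncomputable section

namespace TwistedCentre

open CategoryTheory MonoidalCategory TensorProduct

/-- Normalised 3-cocycles of `G` with values in the multiplicative group of `k`. -/
structure Cocycle₃ (G k : Type u) [Group G] [Field k] where
  toFun : G → G → G → kˣ
  cocycle : ∀ f g h l, toFun g h l * toFun f (g * h) l * toFun f g h =
    toFun (f * g) h l * toFun f g (h * l)
  one_left : ∀ g h, toFun 1 g h = 1
  one_mid : ∀ f h, toFun f 1 h = 1
  one_right : ∀ f g, toFun f g 1 = 1

namespace Cocycle₃

variable {G k : Type u} [Group G] [Field k]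

instance : CoeFun (Cocycle₃ G k) (fun _ => G → G → G → kˣ) := ⟨Cocycle₃.toFun⟩

/-- The restriction of a 3-cocycle to a subgroup. -/
def restrict (α : Cocycle₃ G k) (H : Subgroup G) : Cocycle₃ H k where
  toFun f g h := α f g h
  cocycle f g h l := α.cocycle f g h l
  one_left g h := α.one_left g h
  one_mid f h := α.one_mid f h
  one_right f g := α.one_right f g

variable (α : Cocycle₃ G k)

/-- `α(f,g|h) = α(f,g,h)⁻¹ α(f,ghg⁻¹,g) α(fgh(fg)⁻¹,f,g)⁻¹`. -/
def slant (f g h : G) : kˣ :=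
  (α f g h)⁻¹ * α f (g * h * g⁻¹) g * (α (f * g * h * (f * g)⁻¹) f g)⁻¹

/-- `α(f|g,h) = α(f,g,h) α(fgf⁻¹,f,h)⁻¹ α(fgf⁻¹,fhf⁻¹,f)`. -/
def coslant (f g h : G) : kˣ :=
  α f g h * (α (f * g * f⁻¹) f h)⁻¹ * α (f * g * f⁻¹) (f * h * f⁻¹) f

lemma slant_slant (f g h v : G) :
    α.slant f (g * h) v * α.slant g h v = α.slant (f * g) h v * α.slant f g (h * v * h⁻¹) := by
  have h1 := congrArg Additive.ofMul (α.cocycle f g h v)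
  have h2 := congrArg Additive.ofMul (α.cocycle f g (h * v * h⁻¹) h)
  have h3 := congrArg Additive.ofMul (α.cocycle f (g * h * v * (g * h)⁻¹) g h)
  have h4 := congrArg Additive.ofMul (α.cocycle (f * g * h * v * (f * g * h)⁻¹) f g h)
  apply Additive.ofMul.injective
  simp only [slant, ofMul_mul, ofMul_inv, mul_assoc, mul_inv_rev, inv_mul_cancel, mul_one] at *
  linear_combination (norm := abel) h2 - h1 - h3 + h4

lemma coslant_slant (f g v w : G) :
    α.coslant (f * g) v w * α.slant f g v * α.slant f g w =
      α.slant f g (v * w) * α.coslant g v w * α.coslant f (g * v * g⁻¹) (g * w * g⁻¹) := by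
  have h1 := congrArg Additive.ofMul (α.cocycle f g v w)
  have h2 := congrArg Additive.ofMul (α.cocycle f (g * v * g⁻¹) g w)
  have h3 := congrArg Additive.ofMul (α.cocycle (f * g * v * (f * g)⁻¹) f g w)
  have h4 := congrArg Additive.ofMul (α.cocycle f (g * v * g⁻¹) (g * w * g⁻¹) g)
  have h5 := congrArg Additive.ofMul
    (α.cocycle (f * g * v * (f * g)⁻¹) f (g * w * g⁻¹) g)
  have h6 := congrArg Additive.ofMul
    (α.cocycle (f * g * v * (f * g)⁻¹) (f * g * w * (f * g)⁻¹) f g)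
  apply Additive.ofMul.injective
  simp only [slant, coslant, ofMul_mul, ofMul_inv, mul_assoc, mul_inv_rev, inv_mul_cancel,
    inv_mul_cancel_left, mul_one] at *
  linear_combination (norm := abel) h2 - h1 - h3 - h4 + h5 - h6

lemma coslant_coslant (f g h v : G) :
    α g h v * α.coslant f (g * h) v * α.coslant f g h =
      α.coslant f g (h * v) * α.coslant f h v * α (f * g * f⁻¹) (f * h * f⁻¹) (f * v * f⁻¹) := by
  have h1 := congrArg Additive.ofMul (α.cocycle f g h v)
  have h2 := congrArg Additive.ofMul (α.cocycle (f * g * f⁻¹) f h v)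
  have h3 := congrArg Additive.ofMul (α.cocycle (f * g * f⁻¹) (f * h * f⁻¹) f v)
  have h4 := congrArg Additive.ofMul (α.cocycle (f * g * f⁻¹) (f * h * f⁻¹) (f * v * f⁻¹) f)
  apply Additive.ofMul.injective
  simp only [coslant, ofMul_mul, ofMul_inv, mul_assoc, inv_mul_cancel,
    inv_mul_cancel_left, mul_one] at *
  linear_combination (norm := abel) h1 - h2 + h3 - h4

lemma coslant_mul_slant (f g h : G) :
    α.coslant f g h * α.slant f g h =
      α.coslant f (g * h * g⁻¹) g * α.slant (f * g * f⁻¹) f h := by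
  apply Additive.ofMul.injective
  simp only [slant, coslant, ofMul_mul, ofMul_inv, mul_assoc, mul_inv_rev, inv_mul_cancel, mul_one]
  abel

@[simp] lemma slant_one_left (g h : G) : α.slant 1 g h = 1 := by
  simp [slant, α.one_left, α.one_mid]
@[simp] lemma slant_one_mid (f h : G) : α.slant f 1 h = 1 := by
  simp [slant, α.one_right, α.one_mid]
@[simp] lemma slant_one_right (f g : G) : α.slant f g 1 = 1 := by
  simp [slant, α.one_left, α.one_right, α.one_mid]
@[simp] lemma coslant_one_left (g h : G) : α.coslant 1 g h = 1 := by
  simp [coslant, α.one_left, α.one_right, α.one_mid]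
@[simp] lemma coslant_one_mid (f h : G) : α.coslant f 1 h = 1 := by
  simp [coslant, α.one_left, α.one_mid]
@[simp] lemma coslant_one_right (f g : G) : α.coslant f g 1 = 1 := by
  simp [coslant, α.one_right, α.one_mid]

end Cocycle₃
/-! ### Gradings, given by their families of projections -/

section Grading

variable {G k V W X : Type*} [Field k]
  [AddCommGroup V] [Module k V] [AddCommGroup W] [Module k W] [AddCommGroup X] [Module k X]

/-- The vector `v` is homogeneous of degree `g` with respect to the grading with projections `π`. -/
def IsHomog (π : G → Module.End k V) (g : G) (v : V) : Prop := π g v = v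

lemma IsHomog.smul {π : G → Module.End k V} {g : G} {v : V} (hv : IsHomog π g v) (c : k) :
    IsHomog π g (c • v) := by
  rw [IsHomog, map_smul, hv]

lemma IsHomog.zero (π : G → Module.End k V) (g : G) : IsHomog π g 0 := map_zero _

variable [Fintype G] {π : G → Module.End k V} {σ : G → Module.End k W} {ρ : G → Module.End k X}

lemma isHomog_proj (hπ : CompleteOrthogonalIdempotents π) (g : G) (v : V) :
    IsHomog π g (π g v) :=
  LinearMap.congr_fun (hπ.idem g).eq v

open scoped Classical in
lemma IsHomog.proj_eq (hπ : CompleteOrthogonalIdempotents π) {g : G} {v : V}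
    (hv : IsHomog π g v) (h : G) : π h v = if h = g then v else 0 := by
  split_ifs with e
  · rw [e, hv]
  · rw [← hv]
    exact LinearMap.congr_fun (hπ.ortho e) v

lemma sum_proj (hπ : CompleteOrthogonalIdempotents π) (v : V) : ∑ g, π g v = v := by
  have := LinearMap.congr_fun hπ.complete v
  simpa using this

lemma hext (hπ : CompleteOrthogonalIdempotents π) {φ ψ : V →ₗ[k] W}
    (h : ∀ g v, IsHomog π g v → φ v = ψ v) : φ = ψ := by
  ext v
  rw [← sum_proj hπ v, map_sum, map_sum]
  exact Finset.sum_congr rfl fun g _ => h g _ (isHomog_proj hπ g v)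

lemma hext₂ (hπ : CompleteOrthogonalIdempotents π) (hσ : CompleteOrthogonalIdempotents σ)
    {φ ψ : V ⊗[k] W →ₗ[k] X}
    (h : ∀ g v, IsHomog π g v → ∀ g' w, IsHomog σ g' w → φ (v ⊗ₜ w) = ψ (v ⊗ₜ w)) : φ = ψ := by
  apply TensorProduct.ext
  apply hext hπ
  intro g v hv
  apply hext hσ
  intro g' w hw
  exact h g v hv g' w hw

/-- A linear map that changes degrees by an injective map `c` intertwines the projections. -/
lemma comm_proj (hπ : CompleteOrthogonalIdempotents π) (hσ : CompleteOrthogonalIdempotents σ)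
    (φ : V →ₗ[k] W) (c : G → G) (hc : Function.Injective c)
    (h : ∀ g v, IsHomog π g v → IsHomog σ (c g) (φ v)) (g : G) (v : V) :
    φ (π g v) = σ (c g) (φ v) := by
  classical
  refine LinearMap.congr_fun (f := φ ∘ₗ π g) (g := σ (c g) ∘ₗ φ) (hext hπ ?_) v
  intro g' w hw
  simp only [LinearMap.comp_apply]
  rw [hw.proj_eq hπ, (h g' w hw).proj_eq hσ]
  simp only [hc.eq_iff]
  split_ifs <;> simp

variable [Group G]

/-- The grading of a tensor product: `(V ⊗ W)_f = ⨁_{gh = f} V_g ⊗ W_h`. -/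
def tensorProj (π : G → Module.End k V) (σ : G → Module.End k W) (f : G) :
    Module.End k (V ⊗[k] W) :=
  ∑ g, TensorProduct.map (π g) (σ (g⁻¹ * f))

open scoped Classical in
lemma tensorProj_tmul (hπ : CompleteOrthogonalIdempotents π)
    (hσ : CompleteOrthogonalIdempotents σ) {g h : G} {v : V} {w : W}
    (hv : IsHomog π g v) (hw : IsHomog σ h w) (f : G) :
    tensorProj π σ f (v ⊗ₜ w) = if f = g * h then v ⊗ₜ w else 0 := by
  simp only [tensorProj, LinearMap.sum_apply, TensorProduct.map_tmul, hv.proj_eq hπ,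
    hw.proj_eq hσ]
  rw [Finset.sum_eq_single g]
  · simp only [if_true, inv_mul_eq_iff_eq_mul]
    split_ifs <;> simp
  · intro b _ hb
    simp [hb]
  · simp

lemma IsHomog.tmul (hπ : CompleteOrthogonalIdempotents π)
    (hσ : CompleteOrthogonalIdempotents σ) {g h : G} {v : V} {w : W}
    (hv : IsHomog π g v) (hw : IsHomog σ h w) : IsHomog (tensorProj π σ) (g * h) (v ⊗ₜ w) := by
  classical
  rw [IsHomog, tensorProj_tmul hπ hσ hv hw, if_pos rfl]

lemma tensorProj_grading (hπ : CompleteOrthogonalIdempotents π)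
    (hσ : CompleteOrthogonalIdempotents σ) :
    CompleteOrthogonalIdempotents (tensorProj π σ) := by
  classical
  rw [CompleteOrthogonalIdempotents.iff_ortho_complete]
  constructor
  · intro f f' hf
    refine hext₂ hπ hσ fun g v hv h w hw => ?_
    simp only [Module.End.mul_apply, tensorProj_tmul hπ hσ hv hw, LinearMap.zero_apply]
    split_ifs with e
    · rw [tensorProj_tmul hπ hσ hv hw, if_neg (by rw [← e]; exact hf)]
    · simp
  · refine hext₂ hπ hσ fun g v hv h w hw => ?_
    simp [LinearMap.sum_apply, tensorProj_tmul hπ hσ hv hw]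

/-- A linear map out of `V ⊗ W` that changes the degrees of homogeneous tensors by an injective
map `c` intertwines the projections. -/
lemma comm_proj₂ {τ : G → Module.End k X} (hπ : CompleteOrthogonalIdempotents π)
    (hσ : CompleteOrthogonalIdempotents σ) (hτ : CompleteOrthogonalIdempotents τ)
    (φ : V ⊗[k] W →ₗ[k] X) (c : G → G) (hc : Function.Injective c)
    (h : ∀ g v, IsHomog π g v → ∀ g' w, IsHomog σ g' w → IsHomog τ (c (g * g')) (φ (v ⊗ₜ w)))
    (f : G) (t : V ⊗[k] W) :
    φ (tensorProj π σ f t) = τ (c f) (φ t) := by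
  classical
  refine LinearMap.congr_fun (f := φ ∘ₗ tensorProj π σ f) (g := τ (c f) ∘ₗ φ) (hext₂ hπ hσ ?_) t
  intro g v hv g' w hw
  simp only [LinearMap.comp_apply]
  rw [tensorProj_tmul hπ hσ hv hw, (h g v hv g' w hw).proj_eq hτ]
  simp only [hc.eq_iff]
  split_ifs <;> simp

end Grading

/-! ### The category `𝒵(G, α)` -/

variable {G k : Type u} [Group G] [Fintype G] [Field k]

/-- An object of `𝒵(G, α)`: a finite dimensional `G`-graded vector space with an `α`-projective
`G`-action. The grading is given by the projections `proj g` onto the homogeneous components. As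
`α` is normalised, requiring that all `act f` be automorphisms is the same as requiring
`act 1 = 1`, see `Obj.act_bijective`. -/
structure Obj (α : Cocycle₃ G k) where
  carrier : Type u
  [addCommGroup : AddCommGroup carrier]
  [module : Module k carrier]
  [finite : FiniteDimensional k carrier]
  proj : G → Module.End k carrier
  grading : CompleteOrthogonalIdempotents proj
  act : G → Module.End k carrier
  act_one : act 1 = 1
  act_proj : ∀ f g v, act f (proj g v) = proj (f * g * f⁻¹) (act f v)
  act_mul : ∀ f g h v, act (f * g) (proj h v) = (α.slant f g h : k) • act f (act g (proj h v))

namespace Obj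

variable {α : Cocycle₃ G k}

instance : CoeSort (Obj α) (Type u) := ⟨Obj.carrier⟩

attribute [instance] Obj.addCommGroup Obj.module Obj.finite

/-- `v ∈ X_g`. -/
abbrev Homog (X : Obj α) (g : G) (v : X) : Prop := IsHomog X.proj g v

lemma _root_.TwistedCentre.IsHomog.act {X : Obj α} {g : G} {v : X} (hv : X.Homog g v) (f : G) :
    X.Homog (f * g * f⁻¹) (X.act f v) := by
  rw [Homog, IsHomog, ← X.act_proj, hv]

lemma _root_.TwistedCentre.IsHomog.act_mul {X : Obj α} {h : G} {v : X} (hv : X.Homog h v) (f g : G) :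
    X.act (f * g) v = (α.slant f g h : k) • X.act f (X.act g v) := by
  have := X.act_mul f g h v
  rwa [hv] at this

lemma act_bijective (X : Obj α) (f : G) : Function.Bijective (X.act f) := by
  have key : ∀ f : G, Function.Injective (X.act f) := by
    intro f
    rw [injective_iff_map_eq_zero]
    intro v hv
    rw [← sum_proj X.grading v]
    refine Finset.sum_eq_zero fun g _ => ?_
    have h1 := X.act_mul f⁻¹ f g v
    rw [inv_mul_cancel, X.act_one, X.act_proj f, hv, map_zero, map_zero, smul_zero] at h1
    exact h1
  exact ⟨key f, (LinearMap.injective_iff_surjective).1 (key f)⟩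

/-- Morphisms of `𝒵(G, α)`: linear maps preserving the grading and the action. -/
@[ext] structure Hom (X Y : Obj α) where
  lin : X →ₗ[k] Y
  map_proj : ∀ g v, lin (X.proj g v) = Y.proj g (lin v)
  map_act : ∀ f v, lin (X.act f v) = Y.act f (lin v)

instance : Category (Obj α) where
  Hom := Hom
  id X := ⟨LinearMap.id, fun _ _ => rfl, fun _ _ => rfl⟩
  comp φ ψ := ⟨ψ.lin ∘ₗ φ.lin, by simp [φ.map_proj, ψ.map_proj], by simp [φ.map_act, ψ.map_act]⟩

@[ext] lemma hom_ext {X Y : Obj α} {φ ψ : X ⟶ Y} (h : Hom.lin φ = Hom.lin ψ) : φ = ψ :=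
  Hom.ext h

@[simp] lemma id_lin (X : Obj α) : Hom.lin (𝟙 X) = LinearMap.id := rfl

@[simp] lemma comp_lin {X Y Z : Obj α} (φ : X ⟶ Y) (ψ : Y ⟶ Z) :
    Hom.lin (φ ≫ ψ) = Hom.lin ψ ∘ₗ Hom.lin φ := rfl

lemma map_homog {X Y : Obj α} (φ : X ⟶ Y) {g : G} {v : X} (hv : X.Homog g v) :
    Y.Homog g (Hom.lin φ v) := by
  rw [Homog, IsHomog, ← Hom.map_proj φ, hv]

/-- A morphism from its values on homogeneous vectors. -/
def mkHom {X Y : Obj α} (φ : X →ₗ[k] Y)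
    (h₁ : ∀ g v, X.Homog g v → Y.Homog g (φ v))
    (h₂ : ∀ f g v, X.Homog g v → φ (X.act f v) = Y.act f (φ v)) : X ⟶ Y where
  lin := φ
  map_proj := comm_proj X.grading Y.grading φ id Function.injective_id h₁
  map_act f := LinearMap.congr_fun (f := φ ∘ₗ X.act f) (g := Y.act f ∘ₗ φ)
    (hext X.grading (h₂ f))

/-- A bijective morphism is an isomorphism. -/
def isoOfBijective {X Y : Obj α} (φ : X ⟶ Y) (hφ : Function.Bijective (Hom.lin φ)) : X ≅ Y where
  hom := φ
  inv :=
    { lin := (LinearEquiv.ofBijective (Hom.lin φ) hφ).symm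
      map_proj := fun g v => by
        obtain ⟨w, rfl⟩ := hφ.2 v
        rw [← Hom.map_proj φ]
        simp
      map_act := fun g v => by
        obtain ⟨w, rfl⟩ := hφ.2 v
        rw [← Hom.map_act φ]
        simp }
  hom_inv_id := by
    ext v
    simp
  inv_hom_id := by
    ext v
    simp

section Preadditive

variable (X Y : Obj α)

instance : Zero (X ⟶ Y) := ⟨⟨0, by simp, by simp⟩⟩
instance : Add (X ⟶ Y) := ⟨fun φ ψ => ⟨Hom.lin φ + Hom.lin ψ,
  by simp [Hom.map_proj], by simp [Hom.map_act]⟩⟩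
instance : Neg (X ⟶ Y) := ⟨fun φ => ⟨-Hom.lin φ, by simp [Hom.map_proj], by simp [Hom.map_act]⟩⟩
instance : Sub (X ⟶ Y) := ⟨fun φ ψ => ⟨Hom.lin φ - Hom.lin ψ,
  by simp [Hom.map_proj], by simp [Hom.map_act]⟩⟩
instance : SMul ℕ (X ⟶ Y) := ⟨fun n φ => ⟨n • Hom.lin φ,
  by simp [Hom.map_proj], by simp [Hom.map_act]⟩⟩
instance : SMul ℤ (X ⟶ Y) := ⟨fun n φ => ⟨n • Hom.lin φ,
  by simp [Hom.map_proj], by simp [Hom.map_act]⟩⟩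

instance : AddCommGroup (X ⟶ Y) :=
  Function.Injective.addCommGroup (Hom.lin : (X ⟶ Y) → (X →ₗ[k] Y)) (fun _ _ h => Hom.ext h)
    rfl (fun _ _ => rfl) (fun _ => rfl) (fun _ _ => rfl) (fun _ _ => rfl) (fun _ _ => rfl)

@[simp] lemma zero_lin : Hom.lin (0 : X ⟶ Y) = 0 := rfl
@[simp] lemma add_lin {X Y : Obj α} (φ ψ : X ⟶ Y) : Hom.lin (φ + ψ) = Hom.lin φ + Hom.lin ψ := rfl

instance : Preadditive (Obj α) where

end Preadditive

section Monoidal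

/-- The `α`-projective action on a tensor product, `f.(x ⊗ y) = α(f|g,h) (f.x ⊗ f.y)` for
`x ∈ X_g` and `y ∈ Y_h`. -/
def tensorAct (X Y : Obj α) (f : G) : Module.End k (X ⊗[k] Y) :=
  ∑ g, ∑ h, (α.coslant f g h : k) •
    TensorProduct.map (X.act f ∘ₗ X.proj g) (Y.act f ∘ₗ Y.proj h)

lemma tensorAct_tmul {X Y : Obj α} {g h : G} {x : X} {y : Y} (hx : X.Homog g x)
    (hy : Y.Homog h y) (f : G) :
    tensorAct X Y f (x ⊗ₜ y) = (α.coslant f g h : k) • (X.act f x ⊗ₜ Y.act f y) := by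
  classical
  simp only [tensorAct, LinearMap.sum_apply, LinearMap.smul_apply, TensorProduct.map_tmul,
    LinearMap.comp_apply, hx.proj_eq X.grading, hy.proj_eq Y.grading]
  rw [Finset.sum_eq_single g, Finset.sum_eq_single h] <;> simp +contextual

/-- The tensor product of `𝒵(G, α)`. -/
def tensor (X Y : Obj α) : Obj α where
  carrier := X ⊗[k] Y
  proj := tensorProj X.proj Y.proj
  grading := tensorProj_grading X.grading Y.grading
  act := tensorAct X Y
  act_one := hext₂ X.grading Y.grading fun g x hx h y hy => by
    simp [tensorAct_tmul hx hy, X.act_one, Y.act_one]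
  act_proj f g := comm_proj₂ X.grading Y.grading (tensorProj_grading X.grading Y.grading)
    (tensorAct X Y f) (fun g => f * g * f⁻¹) (MulAut.conj f).injective
    (fun g x hx h y hy => by
      rw [tensorAct_tmul hx hy]
      have := (IsHomog.tmul X.grading Y.grading (hx.act f) (hy.act f)).smul
        (α.coslant f g h : k)
      simpa [mul_assoc] using this) g
  act_mul f g h v := by
    classical
    refine LinearMap.congr_fun (f := tensorAct X Y (f * g) ∘ₗ tensorProj X.proj Y.proj h)
      (g := (α.slant f g h : k) •
        (tensorAct X Y f ∘ₗ tensorAct X Y g ∘ₗ tensorProj X.proj Y.proj h))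
      (hext₂ X.grading Y.grading ?_) v
    intro a x hx b y hy
    simp only [LinearMap.comp_apply, LinearMap.smul_apply,
      tensorProj_tmul X.grading Y.grading hx hy]
    split_ifs with e
    · subst e
      rw [tensorAct_tmul hx hy, tensorAct_tmul hx hy, map_smul,
        tensorAct_tmul (hx.act g) (hy.act g), hx.act_mul, hy.act_mul]
      simp only [TensorProduct.smul_tmul', TensorProduct.tmul_smul, smul_smul, ← Units.val_mul]
      congr 2
      rw [← mul_assoc (α.slant f g (a * b)), ← α.coslant_slant f g a b, mul_right_comm, mul_assoc]
    · simp

/-- The monoidal unit: `k` in degree `1` with the trivial action. -/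
def one (α : Cocycle₃ G k) : Obj α where
  carrier := k
  proj g := open scoped Classical in if g = 1 then 1 else 0
  grading := by
    classical
    rw [CompleteOrthogonalIdempotents.iff_ortho_complete]
    constructor
    · intro g h hgh
      by_cases hg : g = 1
      · have : h ≠ 1 := fun e => hgh (hg.trans e.symm)
        simp [this]
      · simp [hg]
    · simp
  act _ := 1
  act_one := rfl
  act_proj f g v := by
    by_cases hg : g = 1
    · simp [hg]
    · simp [hg]
  act_mul f g h v := by
    by_cases hg : h = 1
    · simp [hg]
    · simp [hg]

lemma one_homog (v : one α) : (one α).Homog 1 v := by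
  simp only [Homog, IsHomog, one, if_true]
  rfl

/-- The tensor `x ⊗ y` as an element of the object `X ⊗ Y`. -/
def tm {X Y : Obj α} (x : X) (y : Y) : tensor X Y := (x ⊗ₜ[k] y : X ⊗[k] Y)

section

variable {X Y Z T : Obj α} {f g h l : G} {x : X} {y : Y} {z : Z} {t : T}

lemma smul_tm (c : k) (x : X) (y : Y) : tm (c • x) y = c • tm x y := rfl

lemma tm_smul (c : k) (x : X) (y : Y) : tm x (c • y) = c • tm x y :=
  TensorProduct.tmul_smul c x y

lemma tm_homog (hx : X.Homog g x) (hy : Y.Homog h y) :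
    (tensor X Y).Homog (g * h) (tm x y) :=
  IsHomog.tmul X.grading Y.grading hx hy

lemma act_tm (hx : X.Homog g x) (hy : Y.Homog h y) (f : G) :
    (tensor X Y).act f (tm x y) = (α.coslant f g h : k) • tm (X.act f x) (Y.act f y) :=
  tensorAct_tmul hx hy f

variable {W : Type*} [AddCommGroup W] [Module k W]

lemma tm_ext {φ ψ : tensor X Y →ₗ[k] W}
    (H : ∀ f x, X.Homog f x → ∀ g y, Y.Homog g y → φ (tm x y) = ψ (tm x y)) : φ = ψ :=
  hext₂ X.grading Y.grading H

lemma tm_ext_left {φ ψ : tensor (tensor X Y) Z →ₗ[k] W}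
    (H : ∀ f x, X.Homog f x → ∀ g y, Y.Homog g y → ∀ h z, Z.Homog h z →
      φ (tm (tm x y) z) = ψ (tm (tm x y) z)) : φ = ψ := by
  apply TensorProduct.ext (R := k) (M := X ⊗[k] Y) (N := Z) (P₂ := W)
  refine hext₂ X.grading Y.grading fun f x hx g y hy => ?_
  refine hext Z.grading fun h z hz => ?_
  exact H f x hx g y hy h z hz

lemma tm_ext_right {φ ψ : tensor X (tensor Y Z) →ₗ[k] W}
    (H : ∀ f x, X.Homog f x → ∀ g y, Y.Homog g y → ∀ h z, Z.Homog h z →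
      φ (tm x (tm y z)) = ψ (tm x (tm y z))) : φ = ψ := by
  apply TensorProduct.ext (R := k) (M := X) (N := Y ⊗[k] Z) (P₂ := W)
  refine hext X.grading fun f x hx => ?_
  refine hext₂ Y.grading Z.grading fun g y hy h z hz => ?_
  exact H f x hx g y hy h z hz

lemma tm_ext_four {φ ψ : tensor (tensor (tensor X Y) Z) T →ₗ[k] W}
    (H : ∀ f x, X.Homog f x → ∀ g y, Y.Homog g y → ∀ h z, Z.Homog h z → ∀ l t, T.Homog l t →
      φ (tm (tm (tm x y) z) t) = ψ (tm (tm (tm x y) z) t)) : φ = ψ := by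
  apply TensorProduct.ext (R := k) (M := (X ⊗[k] Y) ⊗[k] Z) (N := T) (P₂ := W)
  refine tm_ext_left (X := X) (Y := Y) (Z := Z) fun f x hx g y hy h z hz => ?_
  refine hext T.grading fun l t ht => ?_
  exact H f x hx g y hy h z hz l t ht

end

/-- A morphism out of a tensor product from its values on homogeneous tensors. -/
def mkHom₂ {X Y Z : Obj α} (φ : X ⊗[k] Y →ₗ[k] Z)
    (h₁ : ∀ g x, X.Homog g x → ∀ h y, Y.Homog h y → Z.Homog (g * h) (φ (x ⊗ₜ y)))
    (h₂ : ∀ f g x, X.Homog g x → ∀ h y, Y.Homog h y →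
      (α.coslant f g h : k) • φ (X.act f x ⊗ₜ Y.act f y) = Z.act f (φ (x ⊗ₜ y))) :
    tensor X Y ⟶ Z where
  lin := φ
  map_proj := comm_proj₂ X.grading Y.grading Z.grading φ id Function.injective_id h₁
  map_act f := LinearMap.congr_fun (f := φ ∘ₗ tensorAct X Y f) (g := Z.act f ∘ₗ φ)
    (hext₂ X.grading Y.grading fun g x hx h y hy => by
      simp only [LinearMap.comp_apply]
      rw [tensorAct_tmul hx hy, map_smul, h₂ f g x hx h y hy])

/-- The tensor product of morphisms. -/
def tensorMor {X₁ Y₁ X₂ Y₂ : Obj α} (φ : X₁ ⟶ Y₁) (ψ : X₂ ⟶ Y₂) :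
    tensor X₁ X₂ ⟶ tensor Y₁ Y₂ :=
  mkHom₂ (Z := tensor Y₁ Y₂) (TensorProduct.map (Hom.lin φ) (Hom.lin ψ))
    (fun g x hx h y hy => tm_homog (map_homog φ hx) (map_homog ψ hy))
    (fun f g x hx h y hy => by
      change _ • tm (Hom.lin φ (X₁.act f x)) (Hom.lin ψ (X₂.act f y)) =
        (tensor Y₁ Y₂).act f (tm (Hom.lin φ x) (Hom.lin ψ y))
      rw [act_tm (map_homog φ hx) (map_homog ψ hy), Hom.map_act, Hom.map_act])

@[simp] lemma tensorMor_tm {X₁ Y₁ X₂ Y₂ : Obj α} (φ : X₁ ⟶ Y₁) (ψ : X₂ ⟶ Y₂) (x : X₁) (y : X₂) :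
    Hom.lin (tensorMor φ ψ) (tm x y) = tm (Hom.lin φ x) (Hom.lin ψ y) := rfl

/-- The associativity constraint `(X ⊗ Y) ⊗ Z → X ⊗ (Y ⊗ Z)`, the inverse of
`x ⊗ (y ⊗ z) ↦ α(f,g,h) (x ⊗ y) ⊗ z` for `x ∈ X_f`, `y ∈ Y_g`, `z ∈ Z_h`. -/
def assocLin (X Y Z : Obj α) : tensor (tensor X Y) Z →ₗ[k] tensor X (tensor Y Z) :=
  (∑ f, ∑ g, ∑ h, ((α f g h)⁻¹ : kˣ).val •
    (TensorProduct.map (X.proj f) (TensorProduct.map (Y.proj g) (Z.proj h)) ∘ₗ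
      (TensorProduct.assoc k X Y Z).toLinearMap) :
    (X ⊗[k] Y) ⊗[k] Z →ₗ[k] X ⊗[k] (Y ⊗[k] Z))

/-- The associativity constraint `x ⊗ (y ⊗ z) ↦ α(f,g,h) (x ⊗ y) ⊗ z` for `x ∈ X_f`, `y ∈ Y_g`,
`z ∈ Z_h`. -/
def assocInvLin (X Y Z : Obj α) : tensor X (tensor Y Z) →ₗ[k] tensor (tensor X Y) Z :=
  (∑ f, ∑ g, ∑ h, (α f g h : k) •
    (TensorProduct.map (TensorProduct.map (X.proj f) (Y.proj g)) (Z.proj h) ∘ₗ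
      (TensorProduct.assoc k X Y Z).symm.toLinearMap) :
    X ⊗[k] (Y ⊗[k] Z) →ₗ[k] (X ⊗[k] Y) ⊗[k] Z)

section

variable {X Y Z : Obj α} {f g h : G} {x : X} {y : Y} {z : Z}

lemma assocLin_tm (hx : X.Homog f x) (hy : Y.Homog g y) (hz : Z.Homog h z) :
    assocLin X Y Z (tm (tm x y) z) = ((α f g h)⁻¹ : kˣ).val • tm x (tm y z) := by
  classical
  change (∑ f, ∑ g, ∑ h, ((α f g h)⁻¹ : kˣ).val •
    (TensorProduct.map (X.proj f) (TensorProduct.map (Y.proj g) (Z.proj h)) ∘ₗ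
      (TensorProduct.assoc k X Y Z).toLinearMap) :
    (X ⊗[k] Y) ⊗[k] Z →ₗ[k] X ⊗[k] (Y ⊗[k] Z)) ((x ⊗ₜ[k] y) ⊗ₜ[k] z) =
      ((α f g h)⁻¹ : kˣ).val • (x ⊗ₜ[k] (y ⊗ₜ[k] z))
  simp only [LinearMap.sum_apply, LinearMap.smul_apply, TensorProduct.map_tmul,
    LinearMap.comp_apply, LinearEquiv.coe_coe, TensorProduct.assoc_tmul,
    hx.proj_eq X.grading, hy.proj_eq Y.grading, hz.proj_eq Z.grading]
  rw [Finset.sum_eq_single f, Finset.sum_eq_single g, Finset.sum_eq_single h] <;>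
    simp +contextual

lemma assocInvLin_tm (hx : X.Homog f x) (hy : Y.Homog g y) (hz : Z.Homog h z) :
    assocInvLin X Y Z (tm x (tm y z)) = (α f g h : k) • tm (tm x y) z := by
  classical
  change (∑ f, ∑ g, ∑ h, (α f g h : k) •
    (TensorProduct.map (TensorProduct.map (X.proj f) (Y.proj g)) (Z.proj h) ∘ₗ
      (TensorProduct.assoc k X Y Z).symm.toLinearMap) :
    X ⊗[k] (Y ⊗[k] Z) →ₗ[k] (X ⊗[k] Y) ⊗[k] Z) (x ⊗ₜ[k] (y ⊗ₜ[k] z)) =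
      (α f g h : k) • ((x ⊗ₜ[k] y) ⊗ₜ[k] z)
  simp only [LinearMap.sum_apply, LinearMap.smul_apply, TensorProduct.map_tmul,
    LinearMap.comp_apply, LinearEquiv.coe_coe, TensorProduct.assoc_symm_tmul,
    hx.proj_eq X.grading, hy.proj_eq Y.grading, hz.proj_eq Z.grading]
  rw [Finset.sum_eq_single f, Finset.sum_eq_single g, Finset.sum_eq_single h] <;>
    simp +contextual

end

/-- The associativity constraint as a morphism. -/
def assocHom (X Y Z : Obj α) : tensor (tensor X Y) Z ⟶ tensor X (tensor Y Z) where
  lin := assocLin X Y Z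
  map_proj e t := by
    classical
    refine LinearMap.congr_fun (f := assocLin X Y Z ∘ₗ (tensor (tensor X Y) Z).proj e)
      (g := (tensor X (tensor Y Z)).proj e ∘ₗ assocLin X Y Z) (tm_ext_left ?_) t
    intro f x hx g y hy h z hz
    simp only [LinearMap.comp_apply]
    rw [assocLin_tm hx hy hz, map_smul,
      (tm_homog (tm_homog hx hy) hz).proj_eq (tensor (tensor X Y) Z).grading,
      (tm_homog hx (tm_homog hy hz)).proj_eq (tensor X (tensor Y Z)).grading, mul_assoc]
    split_ifs
    · exact assocLin_tm hx hy hz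
    · simp
  map_act e t := by
    refine LinearMap.congr_fun (f := assocLin X Y Z ∘ₗ (tensor (tensor X Y) Z).act e)
      (g := (tensor X (tensor Y Z)).act e ∘ₗ assocLin X Y Z) (tm_ext_left ?_) t
    intro f x hx g y hy h z hz
    simp only [LinearMap.comp_apply]
    rw [assocLin_tm hx hy hz, map_smul, act_tm (tm_homog hx hy) hz,
      act_tm hx hy, act_tm hx (tm_homog hy hz), act_tm hy hz]
    simp only [tm_smul, smul_tm, map_smul, assocLin_tm (hx.act e) (hy.act e) (hz.act e)]
    simp only [smul_smul, ← Units.val_mul]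
    congr 2
    rw [← mul_assoc, eq_inv_mul_iff_mul_eq, ← mul_assoc, ← mul_assoc, α.coslant_coslant e f g h,
      mul_inv_cancel_right]

/-- The associativity isomorphism. -/
def assocIso (X Y Z : Obj α) : tensor (tensor X Y) Z ≅ tensor X (tensor Y Z) :=
  isoOfBijective (assocHom X Y Z) <| by
    have h₁ : assocInvLin X Y Z ∘ₗ assocLin X Y Z = LinearMap.id := tm_ext_left
      fun f x hx g y hy h z hz => by
        simp [assocLin_tm hx hy hz, assocInvLin_tm hx hy hz, smul_smul]
    have h₂ : assocLin X Y Z ∘ₗ assocInvLin X Y Z = LinearMap.id := tm_ext_right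
      fun f x hx g y hy h z hz => by
        simp [assocLin_tm hx hy hz, assocInvLin_tm hx hy hz, smul_smul]
    exact Function.bijective_iff_has_inverse.2
      ⟨assocInvLin X Y Z, LinearMap.congr_fun h₁, LinearMap.congr_fun h₂⟩

lemma assocIso_hom_tm {X Y Z : Obj α} {f g h : G} {x : X} {y : Y} {z : Z}
    (hx : X.Homog f x) (hy : Y.Homog g y) (hz : Z.Homog h z) :
    Hom.lin (assocIso X Y Z).hom (tm (tm x y) z) = ((α f g h)⁻¹ : kˣ).val • tm x (tm y z) :=
  assocLin_tm hx hy hz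

lemma assocIso_inv_tm {X Y Z : Obj α} {f g h : G} {x : X} {y : Y} {z : Z}
    (hx : X.Homog f x) (hy : Y.Homog g y) (hz : Z.Homog h z) :
    Hom.lin (assocIso X Y Z).inv (tm x (tm y z)) = (α f g h : k) • tm (tm x y) z := by
  have h := LinearMap.congr_fun (congrArg Hom.lin (assocIso X Y Z).hom_inv_id) (tm (tm x y) z)
  simp only [comp_lin, LinearMap.comp_apply, assocIso_hom_tm hx hy hz, map_smul, id_lin,
    LinearMap.id_apply] at h
  rw [← h, smul_smul, Units.mul_inv, one_smul]

lemma eq_one_or_eq_zero {g : G} {c : one α} (hc : (one α).Homog g c) : g = 1 ∨ c = 0 := by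
  classical
  by_cases hg : g = 1
  · exact Or.inl hg
  · have h := hc.proj_eq (one α).grading 1
    rw [if_neg (Ne.symm hg), one_homog c] at h
    exact Or.inr h

/-- The left unit isomorphism `k ⊗ X ≅ X`. -/
def lunitIso (X : Obj α) : tensor (one α) X ≅ X :=
  isoOfBijective
    (mkHom₂ (X := one α) (TensorProduct.lid k X).toLinearMap
      (fun g c hc h x hx => by
        obtain rfl | rfl := eq_one_or_eq_zero hc
        · rw [one_mul]
          exact hx.smul c
        · rw [TensorProduct.zero_tmul]
          exact (map_zero (TensorProduct.lid k X)).symm ▸ IsHomog.zero X.proj _)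
      (fun f g c hc h x hx => by
        obtain rfl | rfl := eq_one_or_eq_zero hc
        · rw [α.coslant_one_mid, Units.val_one, one_smul]
          exact (map_smul (X.act f) (show k from c) x).symm
        · rw [map_zero, TensorProduct.zero_tmul, TensorProduct.zero_tmul]
          have h0 := map_zero (TensorProduct.lid k X)
          exact (congrArg _ h0).trans
            ((smul_zero _).trans ((congrArg (X.act f) h0).trans (map_zero _)).symm)))
    (TensorProduct.lid k X).bijective

/-- The right unit isomorphism `X ⊗ k ≅ X`. -/
def runitIso (X : Obj α) : tensor X (one α) ≅ X :=
  isoOfBijective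
    (mkHom₂ (Y := one α) (TensorProduct.rid k X).toLinearMap
      (fun h x hx g c hc => by
        obtain rfl | rfl := eq_one_or_eq_zero hc
        · rw [mul_one]
          exact hx.smul c
        · rw [TensorProduct.tmul_zero]
          exact (map_zero (TensorProduct.rid k X)).symm ▸ IsHomog.zero X.proj _)
      (fun f h x hx g c hc => by
        obtain rfl | rfl := eq_one_or_eq_zero hc
        · rw [α.coslant_one_right, Units.val_one, one_smul]
          exact (map_smul (X.act f) (show k from c) x).symm
        · rw [map_zero, TensorProduct.tmul_zero, TensorProduct.tmul_zero]
          have h0 := map_zero (TensorProduct.rid k X)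
          exact (congrArg _ h0).trans
            ((smul_zero _).trans ((congrArg (X.act f) h0).trans (map_zero _)).symm)))
    (TensorProduct.rid k X).bijective

lemma lunitIso_tm (X : Obj α) (c : k) (x : X) :
    Hom.lin (lunitIso X).hom (tm (X := one α) c x) = c • x := rfl

lemma runitIso_tm (X : Obj α) (c : k) (x : X) :
    Hom.lin (runitIso X).hom (tm (Y := one α) x c) = c • x := rfl

lemma assoc_natural {X₁ X₂ X₃ Y₁ Y₂ Y₃ : Obj α} (φ₁ : X₁ ⟶ Y₁) (φ₂ : X₂ ⟶ Y₂) (φ₃ : X₃ ⟶ Y₃) :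
    tensorMor (tensorMor φ₁ φ₂) φ₃ ≫ (assocIso Y₁ Y₂ Y₃).hom =
      (assocIso X₁ X₂ X₃).hom ≫ tensorMor φ₁ (tensorMor φ₂ φ₃) :=
  hom_ext <| tm_ext_left fun f x hx g y hy h z hz => by
    simp only [comp_lin, LinearMap.comp_apply, tensorMor_tm, assocIso_hom_tm hx hy hz, map_smul,
      assocIso_hom_tm (map_homog φ₁ hx) (map_homog φ₂ hy) (map_homog φ₃ hz)]

lemma assoc_pentagon (W X Y Z : Obj α) :
    tensorMor (assocIso W X Y).hom (𝟙 Z) ≫ (assocIso W (tensor X Y) Z).hom ≫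
      tensorMor (𝟙 W) (assocIso X Y Z).hom =
        (assocIso (tensor W X) Y Z).hom ≫ (assocIso W X (tensor Y Z)).hom :=
  hom_ext <| tm_ext_four fun f w hw g x hx h y hy l z hz => by
    simp only [comp_lin, LinearMap.comp_apply, tensorMor_tm, assocIso_hom_tm hw hx hy, map_smul,
      assocIso_hom_tm (tm_homog hw hx) hy hz, assocIso_hom_tm hw hx (tm_homog hy hz),
      assocIso_hom_tm hw (tm_homog hx hy) hz, assocIso_hom_tm hx hy hz, smul_tm, tm_smul,
      smul_smul, id_lin, LinearMap.id_apply, ← Units.val_mul]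
    congr 2
    rw [← mul_inv, ← mul_inv, ← mul_inv, ← α.cocycle f g h l]
    congr 1
    ac_rfl

lemma unit_triangle (X Y : Obj α) :
    (assocIso X (one α) Y).hom ≫ tensorMor (𝟙 X) (lunitIso Y).hom =
      tensorMor (runitIso X).hom (𝟙 Y) :=
  hom_ext <| tm_ext_left fun f x hx g c hc h y hy => by
    simp only [comp_lin, LinearMap.comp_apply]
    rw [assocIso_hom_tm hx (one_homog c) hy, α.one_mid, inv_one, Units.val_one, one_smul]
    simp only [tensorMor_tm, id_lin, LinearMap.id_apply]
    exact (congrArg (tm x) (lunitIso_tm Y c y)).trans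
      ((tm_smul (show k from c) x y).trans (congrArg (fun v => tm v y) (runitIso_tm X c x)).symm)

/-- The braiding `c(x ⊗ y) = f.y ⊗ x` for `x ∈ X_f`. -/
def braidLin (X Y : Obj α) : X ⊗[k] Y →ₗ[k] tensor Y X :=
  (∑ f, TensorProduct.map (Y.act f) (X.proj f) ∘ₗ (TensorProduct.comm k X Y).toLinearMap :
    X ⊗[k] Y →ₗ[k] Y ⊗[k] X)

lemma braidLin_tm {X Y : Obj α} {f : G} {x : X} (hx : X.Homog f x) (y : Y) :
    braidLin X Y (x ⊗ₜ y) = tm (Y.act f y) x := by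
  classical
  change (∑ f, TensorProduct.map (Y.act f) (X.proj f) ∘ₗ (TensorProduct.comm k X Y).toLinearMap :
    X ⊗[k] Y →ₗ[k] Y ⊗[k] X) (x ⊗ₜ[k] y) = Y.act f y ⊗ₜ[k] x
  simp only [LinearMap.sum_apply, TensorProduct.map_tmul,
    LinearMap.comp_apply, LinearEquiv.coe_coe, TensorProduct.comm_tmul, hx.proj_eq X.grading]
  rw [Finset.sum_eq_single f] <;> simp +contextual

/-- The braiding as a morphism. -/
def braidHom (X Y : Obj α) : tensor X Y ⟶ tensor Y X :=
  mkHom₂ (braidLin X Y)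
    (fun g x hx h y hy => by
      rw [braidLin_tm hx]
      simpa using tm_homog (hy.act g) hx)
    (fun f g x hx h y hy => by
      rw [braidLin_tm hx, braidLin_tm (hx.act f), act_tm (hy.act g) hx]
      have h1 := hy.act_mul (f * g * f⁻¹) f
      have h2 := hy.act_mul f g
      rw [inv_mul_cancel_right, h2] at h1
      have h3 : Y.act (f * g * f⁻¹) (Y.act f y) =
          ((α.slant (f * g * f⁻¹) f h)⁻¹ * α.slant f g h : kˣ).val • Y.act f (Y.act g y) := by
        rw [Units.val_mul, mul_smul, h1, smul_smul, Units.inv_mul, one_smul]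
      rw [h3, smul_tm, smul_smul, ← Units.val_mul]
      congr 2
      rw [mul_left_comm, α.coslant_mul_slant, mul_comm, mul_inv_cancel_right])

/-- The braiding isomorphism. -/
def braidIso (X Y : Obj α) : tensor X Y ≅ tensor Y X :=
  isoOfBijective (braidHom X Y) <| by
    have hs : Function.Surjective (Hom.lin (braidHom X Y)) := by
      rw [← LinearMap.range_eq_top, ← Submodule.ker_mkQ (LinearMap.range (braidHom X Y).lin),
        LinearMap.ker_eq_top]
      refine tm_ext fun g y _ f x hx => ?_
      obtain ⟨y', rfl⟩ := (Y.act_bijective f).2 y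
      rw [LinearMap.zero_apply, Submodule.mkQ_apply, Submodule.Quotient.mk_eq_zero]
      exact ⟨tm x y', braidLin_tm hx y'⟩
    refine ⟨(LinearMap.injective_iff_surjective_of_finrank_eq_finrank ?_).2 hs, hs⟩
    exact (TensorProduct.comm k X Y).finrank_eq

lemma braidIso_tm {X Y : Obj α} {f : G} {x : X} (hx : X.Homog f x) (y : Y) :
    Hom.lin (braidIso X Y).hom (tm x y) = tm (Y.act f y) x :=
  braidLin_tm hx y

lemma braid_natural {X₁ X₂ Y₁ Y₂ : Obj α} (φ : X₁ ⟶ Y₁) (ψ : X₂ ⟶ Y₂) :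
    tensorMor φ ψ ≫ (braidIso Y₁ Y₂).hom = (braidIso X₁ X₂).hom ≫ tensorMor ψ φ :=
  hom_ext <| tm_ext fun f x hx g y hy => by
    simp only [comp_lin, LinearMap.comp_apply, tensorMor_tm, braidIso_tm hx,
      braidIso_tm (map_homog φ hx), Hom.map_act]

lemma braid_hexagon_forward (X Y Z : Obj α) :
    (assocIso X Y Z).hom ≫ (braidIso X (tensor Y Z)).hom ≫ (assocIso Y Z X).hom =
      tensorMor (braidIso X Y).hom (𝟙 Z) ≫ (assocIso Y X Z).hom ≫
        tensorMor (𝟙 Y) (braidIso X Z).hom :=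
  hom_ext <| tm_ext_left fun f x hx g y hy h z hz => by
    simp only [comp_lin, LinearMap.comp_apply, tensorMor_tm, assocIso_hom_tm hx hy hz, map_smul,
      braidIso_tm hx, act_tm hy hz, assocIso_hom_tm (hy.act f) hx hz,
      assocIso_hom_tm (hy.act f) (hz.act f) hx, smul_tm,
      smul_smul, id_lin, LinearMap.id_apply, ← Units.val_mul]
    congr 2
    rw [Cocycle₃.coslant]
    simp [mul_assoc]

lemma braid_hexagon_reverse (X Y Z : Obj α) :
    (assocIso X Y Z).inv ≫ (braidIso (tensor X Y) Z).hom ≫ (assocIso Z X Y).inv =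
      tensorMor (𝟙 X) (braidIso Y Z).hom ≫ (assocIso X Z Y).inv ≫
        tensorMor (braidIso X Z).hom (𝟙 Y) :=
  hom_ext <| tm_ext_right fun f x hx g y hy h z hz => by
    simp only [comp_lin, LinearMap.comp_apply, tensorMor_tm, assocIso_inv_tm hx hy hz, map_smul,
      braidIso_tm hx, braidIso_tm hy, braidIso_tm (tm_homog hx hy), hz.act_mul f g,
      assocIso_inv_tm hx (hz.act g) hy, assocIso_inv_tm ((hz.act g).act f) hx hy, smul_tm,
      smul_smul, id_lin, LinearMap.id_apply, ← Units.val_mul]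
    congr 2
    rw [Cocycle₃.slant]
    simp [mul_assoc]

instance : MonoidalCategoryStruct (Obj α) where
  tensorObj := tensor
  whiskerLeft X _ _ φ := tensorMor (𝟙 X) φ
  whiskerRight φ Y := tensorMor φ (𝟙 Y)
  tensorHom := tensorMor
  tensorUnit := one α
  associator := assocIso
  leftUnitor := lunitIso
  rightUnitor := runitIso

instance : MonoidalCategory (Obj α) := MonoidalCategory.ofTensorHom
  (id_tensorHom_id := fun X Y => hom_ext (tm_ext (X := X) (Y := Y) fun _ _ _ _ _ _ => rfl))
  (id_tensorHom := fun _ _ _ _ => rfl)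
  (tensorHom_id := fun _ _ => rfl)
  (tensorHom_comp_tensorHom := fun {X₁ _ _ X₂ _ _} _ _ _ _ =>
    hom_ext (tm_ext (X := X₁) (Y := X₂) fun _ _ _ _ _ _ => rfl))
  (associator_naturality := assoc_natural)
  (leftUnitor_naturality := fun {X _} φ => hom_ext <| tm_ext (X := one α) (Y := X)
    fun _ c _ _ x _ => (map_smul (Hom.lin φ) (show k from c) x).symm)
  (rightUnitor_naturality := fun {X _} φ => hom_ext <| tm_ext (X := X) (Y := one α)
    fun _ x _ _ c _ => (map_smul (Hom.lin φ) (show k from c) x).symm)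
  (pentagon := assoc_pentagon)
  (triangle := unit_triangle)

instance : BraidedCategory (Obj α) where
  braiding := braidIso
  braiding_naturality_right X _ _ φ := braid_natural (𝟙 X) φ
  braiding_naturality_left φ Z := braid_natural φ (𝟙 Z)
  hexagon_forward := braid_hexagon_forward
  hexagon_reverse := braid_hexagon_reverse

end Monoidal

end Obj

/-! ### Modules, local modules and Lagrangian algebras -/

section Lagrangian

open MonObj

variable {C : Type*} [Category C] [MonoidalCategory C]

/-- A right module over an algebra `A` in a monoidal category. -/
structure RightMod (A : C) [MonObj A] where
  X : C
  act : X ⊗ A ⟶ X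
  act_one : X ◁ η[A] ≫ act = (ρ_ X).hom
  act_act : act ▷ A ≫ act = (α_ X A A).hom ≫ X ◁ μ[A] ≫ act

namespace RightMod

variable (A : C) [MonObj A]

/-- The regular right module. -/
def regular : RightMod A where
  X := A
  act := μ[A]
  act_one := mul_one A
  act_act := mul_assoc A

variable {A}

/-- Homomorphisms of right modules. -/
def IsModHom (M N : RightMod A) (φ : M.X ⟶ N.X) : Prop :=
  M.act ≫ φ = φ ▷ A ≫ N.act

/-- A right module is local if its action is unchanged by the double braiding. -/
def IsLocal [BraidedCategory C] (M : RightMod A) : Prop :=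
  (β_ M.X A).hom ≫ (β_ A M.X).hom ≫ M.act = M.act

/-- The module `M` is a (finite) direct sum of copies of the regular module. -/
def IsSumOfRegular [Preadditive C] (M : RightMod A) : Prop :=
  ∃ (n : ℕ) (i : Fin n → ((regular A).X ⟶ M.X)) (p : Fin n → (M.X ⟶ (regular A).X)),
    (∀ a, IsModHom (regular A) M (i a)) ∧ (∀ a, IsModHom M (regular A) (p a)) ∧
    (∀ a, i a ≫ p a = 𝟙 _) ∧ (∀ a b, a ≠ b → i a ≫ p b = 0) ∧ ∑ a, p a ≫ i a = 𝟙 M.X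

end RightMod

/-- A Lagrangian algebra: a nonzero commutative algebra such that every local module over it is a
direct sum of copies of the regular module. (Over the zero algebra every module is zero, so that
the condition on local modules would hold there for an empty reason.) -/
structure IsLagrangian [BraidedCategory C] [Preadditive C] (A : C) [MonObj A] : Prop where
  comm : IsCommMonObj A
  nonzero : ¬ Limits.IsZero A
  free : ∀ M : RightMod A, M.IsLocal → M.IsSumOfRegular

end Lagrangian

/-! ### The transfer functor `E` -/

namespace Obj

section Transfer

set_option linter.unusedSectionVars false

variable {α : Cocycle₃ G k} {H : Subgroup G} [Fintype H]

/-- The grading of an `H`-graded space, viewed as a `G`-grading with support in `H`. -/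
def extProj (V : Obj (α.restrict H)) (g : G) : Module.End k V :=
  open scoped Classical in if hg : g ∈ H then V.proj ⟨g, hg⟩ else 0

lemma extProj_coe (V : Obj (α.restrict H)) (h : H) : V.extProj (h : G) = V.proj h := by
  simp [extProj]

lemma extProj_of_notMem (V : Obj (α.restrict H)) {g : G} (hg : g ∉ H) : V.extProj g = 0 := by
  simp [extProj, hg]

lemma extProj_grading (V : Obj (α.restrict H)) : CompleteOrthogonalIdempotents V.extProj := by
  classical
  rw [CompleteOrthogonalIdempotents.iff_ortho_complete]
  constructor
  · intro g g' hgg'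
    by_cases hg : g ∈ H
    · by_cases hg' : g' ∈ H
      · change V.extProj g * V.extProj g' = 0
        rw [extProj, extProj, dif_pos hg, dif_pos hg']
        exact V.grading.ortho (by simpa using hgg')
      · simp [V.extProj_of_notMem hg']
    · simp [V.extProj_of_notMem hg]
  · rw [← V.grading.complete, ← Finset.sum_subset (Finset.subset_univ
      (Finset.univ.map (Function.Embedding.subtype (· ∈ H)))), Finset.sum_map]
    · exact Finset.sum_congr rfl fun h _ => V.extProj_coe h
    · intro g _ hg
      apply V.extProj_of_notMem
      simpa using hg

/-- `v` is homogeneous of degree `g ∈ G`. -/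
abbrev ExtHomog (V : Obj (α.restrict H)) (g : G) (v : V) : Prop := IsHomog V.extProj g v

lemma ExtHomog.cases {V : Obj (α.restrict H)} {g : G} {v : V} (hv : V.ExtHomog g v) :
    v = 0 ∨ ∃ h : H, (h : G) = g ∧ V.Homog h v := by
  by_cases hg : g ∈ H
  · refine Or.inr ⟨⟨g, hg⟩, rfl, ?_⟩
    rw [Homog, IsHomog, ← V.extProj_coe]
    exact hv
  · left
    rw [← hv, V.extProj_of_notMem hg, LinearMap.zero_apply]

lemma Homog.ext {V : Obj (α.restrict H)} {h : H} {v : V} (hv : V.Homog h v) :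
    V.ExtHomog h v := by
  rw [ExtHomog, IsHomog, V.extProj_coe, hv]

lemma ExtHomog.act {V : Obj (α.restrict H)} {g : G} {v : V} (hv : V.ExtHomog g v) (h : H) :
    V.ExtHomog (h * g * h⁻¹) (V.act h v) := by
  obtain rfl | ⟨g, rfl, hv'⟩ := hv.cases
  · rw [map_zero]
    exact IsHomog.zero _ _
  · exact Homog.ext (IsHomog.act hv' h)

lemma ExtHomog.act_mul {V : Obj (α.restrict H)} {g : G} {v : V} (hv : V.ExtHomog g v)
    (h h' : H) :
    V.act (h * h') v = (α.slant h h' g : k) • V.act h (V.act h' v) := by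
  obtain rfl | ⟨g, rfl, hv'⟩ := hv.cases
  · simp
  · exact IsHomog.act_mul hv' h h'

/-- The grading on `Map(G, V)`: `|a| = f` iff `|a(x)| = x⁻¹ f x` for all `x`. -/
def mapProj (V : Obj (α.restrict H)) (f : G) : Module.End k (G → V) :=
  LinearMap.pi fun x => V.extProj (x⁻¹ * f * x) ∘ₗ LinearMap.proj x

@[simp] lemma mapProj_apply (V : Obj (α.restrict H)) (f : G) (a : G → V) (x : G) :
    V.mapProj f a x = V.extProj (x⁻¹ * f * x) (a x) := rfl

lemma mapHomog_iff {V : Obj (α.restrict H)} {f : G} {a : G → V} :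
    IsHomog V.mapProj f a ↔ ∀ x, V.ExtHomog (x⁻¹ * f * x) (a x) :=
  funext_iff

lemma mapProj_grading (V : Obj (α.restrict H)) : CompleteOrthogonalIdempotents V.mapProj := by
  rw [CompleteOrthogonalIdempotents.iff_ortho_complete]
  constructor
  · intro f g hfg
    ext a x
    exact LinearMap.congr_fun (V.extProj_grading.ortho (i := x⁻¹ * f * x) (j := x⁻¹ * g * x)
      (by simpa using hfg)) (a x)
  · refine LinearMap.ext fun a => funext fun x => ?_
    simp only [LinearMap.sum_apply, Finset.sum_apply, mapProj_apply, Module.End.one_apply]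
    refine Eq.trans ?_ (sum_proj V.extProj_grading (a x))
    exact Fintype.sum_equiv (MulAut.conj x⁻¹).toEquiv _ (fun g => V.extProj g (a x))
      (fun g => by simp)

/-- The `α`-projective action of `G` on `Map(G, V)`:
`(g.a)(x) = α(x⁻¹,g|f)⁻¹ a(g⁻¹x)` for `|a| = f`. -/
def mapAct (V : Obj (α.restrict H)) (g : G) : Module.End k (G → V) :=
  LinearMap.pi fun x => ∑ f, ((α.slant x⁻¹ g f)⁻¹ : kˣ).val •
    (LinearMap.proj (g⁻¹ * x) ∘ₗ V.mapProj f)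

lemma mapAct_apply {V : Obj (α.restrict H)} {f : G} {a : G → V} (ha : IsHomog V.mapProj f a)
    (g x : G) : V.mapAct g a x = ((α.slant x⁻¹ g f)⁻¹ : kˣ).val • a (g⁻¹ * x) := by
  classical
  simp only [mapAct, LinearMap.pi_apply, LinearMap.sum_apply, LinearMap.smul_apply,
    LinearMap.comp_apply, LinearMap.proj_apply, ha.proj_eq V.mapProj_grading]
  rw [Finset.sum_eq_single f] <;> simp +contextual

lemma mapHomog_act {V : Obj (α.restrict H)} {f : G} {a : G → V} (ha : IsHomog V.mapProj f a)
    (g : G) : IsHomog V.mapProj (g * f * g⁻¹) (V.mapAct g a) := by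
  rw [mapHomog_iff]
  intro x
  rw [mapAct_apply ha]
  have := (mapHomog_iff.1 ha (g⁻¹ * x)).smul ((α.slant x⁻¹ g f)⁻¹ : kˣ).val
  simpa [mul_assoc] using this

/-- The subspace `E(V)` of `Map(G, V)`, spanned by the homogeneous `a` with
`a(xh) = α(h⁻¹,x⁻¹|f) h⁻¹.a(x)` for `h ∈ H`, `x ∈ G`, where `|a| = f`. -/
def transferSubmodule (V : Obj (α.restrict H)) : Submodule k (G → V) where
  carrier := {a | ∀ (f x : G) (h : H), V.mapProj f a (x * h) =
    (α.slant (h : G)⁻¹ x⁻¹ f : k) • V.act h⁻¹ (V.mapProj f a x)}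
  zero_mem' f x h := by simp
  add_mem' ha hb f x h := by simp only [map_add, Pi.add_apply, ha f x h, hb f x h, smul_add]
  smul_mem' c a ha f x h := by
    simp only [map_smul, Pi.smul_apply, ha f x h]
    rw [smul_comm]

lemma mem_transfer_iff {V : Obj (α.restrict H)} {f : G} {a : G → V}
    (ha : IsHomog V.mapProj f a) : a ∈ V.transferSubmodule ↔
      ∀ (x : G) (h : H), a (x * h) = (α.slant (h : G)⁻¹ x⁻¹ f : k) • V.act h⁻¹ (a x) := by
  classical
  constructor
  · intro h x y
    have := h f x y
    rwa [ha] at this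
  · intro h g x y
    rw [ha.proj_eq V.mapProj_grading]
    split_ifs with e
    · rw [e, h]
    · simp

lemma proj_mem_transfer {V : Obj (α.restrict H)} {a : G → V} (ha : a ∈ V.transferSubmodule)
    (f : G) : V.mapProj f a ∈ V.transferSubmodule :=
  (mem_transfer_iff (isHomog_proj V.mapProj_grading f a)).2 (ha f)

lemma act_mem_transfer {V : Obj (α.restrict H)} {a : G → V} (ha : a ∈ V.transferSubmodule)
    (g : G) : V.mapAct g a ∈ V.transferSubmodule := by
  rw [← sum_proj V.mapProj_grading a, map_sum]
  refine Submodule.sum_mem _ fun f _ => ?_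
  have hb := proj_mem_transfer ha f
  have hf := isHomog_proj V.mapProj_grading f a
  generalize V.mapProj f a = b at hb hf
  rw [mem_transfer_iff hf] at hb
  rw [mem_transfer_iff (mapHomog_act hf g)]
  intro x h
  rw [mapAct_apply hf, mapAct_apply hf, ← mul_assoc, hb, map_smul, smul_smul, smul_smul,
    ← Units.val_mul, ← Units.val_mul]
  congr 2
  have := α.slant_slant (h : G)⁻¹ x⁻¹ g f
  rw [inv_mul_eq_iff_eq_mul, mul_inv_rev, mul_inv_rev, inv_inv, ← mul_assoc, ← this,
    mul_inv_cancel_right]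

/-- The object `E(V)` of `𝒵(G, α)` for an object `V` of `𝒵(H, α|_H)`. -/
def transfer (V : Obj (α.restrict H)) : Obj α where
  carrier := V.transferSubmodule
  proj f := (V.mapProj f).restrict fun _ ha => proj_mem_transfer ha f
  grading := by
    rw [CompleteOrthogonalIdempotents.iff_ortho_complete]
    constructor
    · intro f g hfg
      ext1 a
      exact Subtype.ext (LinearMap.congr_fun (V.mapProj_grading.ortho hfg) a.1)
    · ext1 a
      apply Subtype.ext
      simp only [LinearMap.sum_apply, Module.End.one_apply, Submodule.coe_sum,
        LinearMap.coe_restrict_apply]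
      exact sum_proj V.mapProj_grading a.1
  act g := (V.mapAct g).restrict fun _ ha => act_mem_transfer ha g
  act_one := by
    ext1 a
    apply Subtype.ext
    simp only [LinearMap.coe_restrict_apply]
    refine LinearMap.congr_fun (f := V.mapAct 1) (g := 1) (hext V.mapProj_grading ?_) a.1
    intro f b hb
    funext x
    simp [mapAct_apply hb]
  act_proj f g a := Subtype.ext <| comm_proj V.mapProj_grading V.mapProj_grading
    (V.mapAct f) (fun g => f * g * f⁻¹) (MulAut.conj f).injective
    (fun _ _ hb => mapHomog_act hb f) g a.1
  act_mul f g h a := Subtype.ext <| by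
    have hb := isHomog_proj V.mapProj_grading h a.1
    funext x
    change V.mapAct (f * g) (V.mapProj h a.1) x =
      (α.slant f g h : k) • V.mapAct f (V.mapAct g (V.mapProj h a.1)) x
    generalize V.mapProj h a.1 = b at hb
    rw [mapAct_apply hb, mapAct_apply (mapHomog_act hb g), mapAct_apply hb]
    simp only [smul_smul, ← Units.val_mul, mul_inv_rev, inv_inv, mul_assoc]
    congr 2
    have := α.slant_slant x⁻¹ f g h
    rw [inv_eq_iff_mul_eq_one]
    simp only [mul_assoc] at this ⊢
    rw [← mul_assoc, this]
    group

/-! The transfer of an algebra is an algebra. -/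

open MonObj

/-- The product of two elements of an algebra in `𝒵(G, α)`. -/
def mulBil (B : Obj α) [MonObj B] : B →ₗ[k] B →ₗ[k] B :=
  TensorProduct.curry (show B ⊗[k] B →ₗ[k] B from Hom.lin μ[B])

/-- The unit element of an algebra in `𝒵(G, α)`. -/
def unitElt (B : Obj α) [MonObj B] : B := Hom.lin η[B] (1 : k)

section

variable {B : Obj α} [MonObj B]

lemma unitElt_homog : B.Homog 1 B.unitElt := map_homog η[B] (one_homog _)

lemma act_unitElt (f : G) : B.act f B.unitElt = B.unitElt :=
  (Hom.map_act η[B] f (1 : k)).symm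

lemma unitElt_mul (b : B) : B.mulBil B.unitElt b = b := by
  have h := LinearMap.congr_fun (congrArg Hom.lin (one_mul B)) (tm (X := one α) (1 : k) b)
  exact h.trans (one_smul k b)

lemma mul_unitElt (b : B) : B.mulBil b B.unitElt = b := by
  have h := LinearMap.congr_fun (congrArg Hom.lin (mul_one B)) (tm (Y := one α) b (1 : k))
  exact h.trans (one_smul k b)

lemma mulBil_homog {f g : G} {a b : B} (ha : B.Homog f a) (hb : B.Homog g b) :
    B.Homog (f * g) (B.mulBil a b) := map_homog μ[B] (tm_homog ha hb)

lemma act_mulBil {g h : G} {a b : B} (ha : B.Homog g a) (hb : B.Homog h b) (f : G) :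
    B.act f (B.mulBil a b) = (α.coslant f g h : k) • B.mulBil (B.act f a) (B.act f b) := by
  have h1 := Hom.map_act μ[B] f (tm a b)
  refine h1.symm.trans ((congrArg _ (act_tm ha hb f)).trans ?_)
  exact map_smul (Hom.lin μ[B]) _ _

lemma mulBil_assoc {f g h : G} {a b c : B} (ha : B.Homog f a) (hb : B.Homog g b)
    (hc : B.Homog h c) :
    B.mulBil a (B.mulBil b c) = (α f g h : k) • B.mulBil (B.mulBil a b) c := by
  have h1 := LinearMap.congr_fun (congrArg Hom.lin (mul_assoc B)) (tm (tm a b) c)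
  have h2 : B.mulBil (B.mulBil a b) c = ((α f g h)⁻¹ : kˣ).val • B.mulBil a (B.mulBil b c) := by
    refine h1.trans ?_
    change Hom.lin μ[B] (Hom.lin (B ◁ μ[B]) (assocLin B B B (tm (tm a b) c))) = _
    rw [assocLin_tm ha hb hc]
    refine (congrArg (Hom.lin μ[B]) (map_smul (Hom.lin (B ◁ μ[B])) _ _)).trans ?_
    exact map_smul (Hom.lin μ[B]) _ _
  rw [h2, smul_smul, Units.mul_inv, one_smul]

end

/-- An algebra in `𝒵(G, α)` from a graded `α`-associative product and a unit. -/
@[reducible] def mkMonObj (A : Obj α) (m : A →ₗ[k] A →ₗ[k] A) (e : A) (he : A.Homog 1 e)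
    (hact : ∀ f, A.act f e = e) (h_one : ∀ a, m e a = a) (h_one' : ∀ a, m a e = a)
    (h_deg : ∀ f g a b, A.Homog f a → A.Homog g b → A.Homog (f * g) (m a b))
    (h_act : ∀ f g h a b, A.Homog g a → A.Homog h b →
      (α.coslant f g h : k) • m (A.act f a) (A.act f b) = A.act f (m a b))
    (h_assoc : ∀ f g h a b c, A.Homog f a → A.Homog g b → A.Homog h c →
      m a (m b c) = (α f g h : k) • m (m a b) c) : MonObj A where
  one := mkHom (X := one α) (Y := A) (LinearMap.toSpanSingleton k A e)
    (fun g c hc => by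
      obtain rfl | rfl := eq_one_or_eq_zero hc
      · exact he.smul c
      · change A.Homog g ((0 : k) • e)
        rw [zero_smul]
        exact IsHomog.zero A.proj g)
    (fun f g c hc => by
      change (show k from c) • e = A.act f ((show k from c) • e)
      rw [map_smul, hact])
  mul := mkHom₂ (TensorProduct.lift m)
    (fun g x hx h y hy => h_deg g h x y hx hy)
    (fun f g x hx h y hy => h_act f g h x y hx hy)
  one_mul := hom_ext <| tm_ext (X := one α) (Y := A) fun _ c _ _ a _ => by
    change m ((show k from c) • e) a = (show k from c) • a
    rw [map_smul, LinearMap.smul_apply, h_one]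
  mul_one := hom_ext <| tm_ext (X := A) (Y := one α) fun _ a _ _ c _ => by
    change m a ((show k from c) • e) = (show k from c) • a
    rw [map_smul, h_one']
  mul_assoc := hom_ext <| tm_ext_left (X := A) (Y := A) (Z := A) fun f a ha g b hb h c hc => by
    let M : tensor A A ⟶ A := mkHom₂ (TensorProduct.lift m)
      (fun g x hx h y hy => h_deg g h x y hx hy) (fun f g x hx h y hy => h_act f g h x y hx hy)
    change m (m a b) c = Hom.lin M (Hom.lin (tensorMor (𝟙 A) M) (assocLin A A A (tm (tm a b) c)))
    rw [assocLin_tm ha hb hc, map_smul, map_smul]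
    change _ = _ • m a (m b c)
    rw [h_assoc f g h a b c ha hb hc, smul_smul, Units.inv_mul, one_smul]

section

variable (B : Obj (α.restrict H)) [MonObj B]

lemma ext_unitElt : B.ExtHomog 1 B.unitElt := Homog.ext (h := 1) unitElt_homog

variable {B}

lemma ext_mul {f g : G} {a b : B} (ha : B.ExtHomog f a) (hb : B.ExtHomog g b) :
    B.ExtHomog (f * g) (B.mulBil a b) := by
  obtain rfl | ⟨f, rfl, ha'⟩ := ha.cases
  · simpa using IsHomog.zero _ _
  obtain rfl | ⟨g, rfl, hb'⟩ := hb.cases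
  · simpa using IsHomog.zero _ _
  exact Homog.ext (h := f * g) (mulBil_homog ha' hb')

lemma ext_act_mul {f g : G} {a b : B} (ha : B.ExtHomog f a) (hb : B.ExtHomog g b) (h : H) :
    B.act h (B.mulBil a b) = (α.coslant h f g : k) • B.mulBil (B.act h a) (B.act h b) := by
  obtain rfl | ⟨f, rfl, ha'⟩ := ha.cases
  · simp
  obtain rfl | ⟨g, rfl, hb'⟩ := hb.cases
  · simp
  exact act_mulBil ha' hb' h

lemma ext_mul_assoc {f g h : G} {a b c : B} (ha : B.ExtHomog f a) (hb : B.ExtHomog g b)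
    (hc : B.ExtHomog h c) :
    B.mulBil a (B.mulBil b c) = (α f g h : k) • B.mulBil (B.mulBil a b) c := by
  obtain rfl | ⟨f, rfl, ha'⟩ := ha.cases
  · simp
  obtain rfl | ⟨g, rfl, hb'⟩ := hb.cases
  · simp
  obtain rfl | ⟨h, rfl, hc'⟩ := hc.cases
  · simp
  exact mulBil_assoc ha' hb' hc'

variable (B)

/-- The product `(ab)(x) = α(x⁻¹|f,g) a(x) b(x)` on `Map(G, B)`, for `|a| = f` and `|b| = g`. -/
def mapMul : (G → B) →ₗ[k] (G → B) →ₗ[k] (G → B) :=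
  LinearMap.mk₂ k (fun a b x => ∑ f, ∑ g, (α.coslant x⁻¹ f g : k) •
      B.mulBil (B.mapProj f a x) (B.mapProj g b x))
    (fun a a' b => by
      funext x
      simp only [map_add, Pi.add_apply, LinearMap.add_apply, smul_add, Finset.sum_add_distrib])
    (fun c a b => by
      funext x
      simp only [map_smul, Pi.smul_apply, LinearMap.smul_apply, Finset.smul_sum, smul_comm c])
    (fun a b b' => by
      funext x
      simp only [map_add, Pi.add_apply, smul_add, Finset.sum_add_distrib])
    (fun c a b => by
      funext x
      simp only [map_smul, Pi.smul_apply, Finset.smul_sum, smul_comm c])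

variable {B}

lemma mapMul_apply {f g : G} {a b : G → B} (ha : IsHomog B.mapProj f a)
    (hb : IsHomog B.mapProj g b) (x : G) :
    B.mapMul a b x = (α.coslant x⁻¹ f g : k) • B.mulBil (a x) (b x) := by
  classical
  simp only [mapMul, LinearMap.mk₂_apply, ha.proj_eq B.mapProj_grading,
    hb.proj_eq B.mapProj_grading]
  rw [Finset.sum_eq_single f, Finset.sum_eq_single g] <;> simp +contextual

lemma mapMul_homog {f g : G} {a b : G → B} (ha : IsHomog B.mapProj f a)
    (hb : IsHomog B.mapProj g b) : IsHomog B.mapProj (f * g) (B.mapMul a b) := by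
  rw [mapHomog_iff] at *
  intro x
  rw [mapMul_apply (mapHomog_iff.2 ha) (mapHomog_iff.2 hb)]
  have := (ext_mul (ha x) (hb x)).smul (α.coslant x⁻¹ f g : k)
  simpa [_root_.mul_assoc] using this

lemma mapMul_mem {a b : G → B} (ha : a ∈ B.transferSubmodule) (hb : b ∈ B.transferSubmodule) :
    B.mapMul a b ∈ B.transferSubmodule := by
  rw [← sum_proj B.mapProj_grading a, ← sum_proj B.mapProj_grading b, map_sum]
  refine Submodule.sum_mem _ fun g _ => ?_
  rw [map_sum, LinearMap.sum_apply]
  refine Submodule.sum_mem _ fun f _ => ?_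
  have ha' := proj_mem_transfer ha f
  have hb' := proj_mem_transfer hb g
  have hf := isHomog_proj B.mapProj_grading f a
  have hg := isHomog_proj B.mapProj_grading g b
  generalize B.mapProj f a = a' at ha' hf
  generalize B.mapProj g b = b' at hb' hg
  rw [mem_transfer_iff hf] at ha'
  rw [mem_transfer_iff hg] at hb'
  rw [mem_transfer_iff (mapMul_homog hf hg)]
  intro x h
  rw [mapMul_apply hf hg, mapMul_apply hf hg, ha', hb', map_smul, map_smul,
    LinearMap.smul_apply, map_smul,
    ext_act_mul (mapHomog_iff.1 hf x) (mapHomog_iff.1 hg x)]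
  simp only [smul_smul, ← Units.val_mul]
  congr 2
  have := α.coslant_slant (h : G)⁻¹ x⁻¹ f g
  simp only [inv_inv, mul_inv_rev, InvMemClass.coe_inv] at this ⊢
  rw [← _root_.mul_assoc, ← _root_.mul_assoc, ← this]
  ac_rfl

lemma const_homog {b : B} (hb : B.ExtHomog 1 b) :
    IsHomog B.mapProj 1 (fun _ : G => b) := by
  rw [mapHomog_iff]
  intro x
  simpa using hb

variable (B) in
/-- The unit of `E(B)` is the constant map with value the unit of `B`. -/
lemma const_mem : (fun _ : G => B.unitElt) ∈ B.transferSubmodule := by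
  rw [mem_transfer_iff (const_homog B.ext_unitElt)]
  intro x h
  simp [act_unitElt]

lemma transfer_homog_iff {f : G} {a : B.transfer} :
    B.transfer.Homog f a ↔ IsHomog B.mapProj f a.1 :=
  Subtype.ext_iff

variable (B) in
/-- The product on `E(B)`. -/
def transferMul : B.transfer →ₗ[k] B.transfer →ₗ[k] B.transfer :=
  LinearMap.mk₂ k (fun a b => ⟨B.mapMul a.1 b.1, mapMul_mem a.2 b.2⟩)
    (fun a a' b => Subtype.ext (LinearMap.map_add₂ B.mapMul a.1 a'.1 b.1))
    (fun c a b => Subtype.ext (LinearMap.map_smul₂ B.mapMul c a.1 b.1))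
    (fun a b b' => Subtype.ext (map_add (B.mapMul a.1) b.1 b'.1))
    (fun c a b => Subtype.ext (map_smul (B.mapMul a.1) c b.1))

/-- The algebra structure on `E(B)` for an algebra `B` in `𝒵(H, α|_H)`. -/
instance transferMonObj : MonObj B.transfer :=
  mkMonObj B.transfer B.transferMul ⟨fun _ => B.unitElt, B.const_mem⟩
    (transfer_homog_iff.2 (const_homog B.ext_unitElt))
    (fun f => Subtype.ext <| funext fun x => by
      change B.mapAct f (fun _ => B.unitElt) x = B.unitElt
      rw [mapAct_apply (const_homog B.ext_unitElt)]
      simp)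
    (fun a => Subtype.ext <| by
      refine LinearMap.congr_fun (f := B.mapMul fun _ => B.unitElt) (g := LinearMap.id)
        (hext B.mapProj_grading fun f b hb => funext fun x => ?_) a.1
      rw [mapMul_apply (const_homog B.ext_unitElt) hb]
      simp [unitElt_mul])
    (fun a => Subtype.ext <| by
      refine LinearMap.congr_fun (f := B.mapMul.flip fun _ => B.unitElt) (g := LinearMap.id)
        (hext B.mapProj_grading fun f b hb => funext fun x => ?_) a.1
      rw [LinearMap.flip_apply, mapMul_apply hb (const_homog B.ext_unitElt)]
      simp [mul_unitElt])
    (fun f g a b ha hb => by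
      rw [transfer_homog_iff] at *
      exact mapMul_homog ha hb)
    (fun f g h a b ha hb => Subtype.ext <| funext fun x => by
      rw [transfer_homog_iff] at ha hb
      change (α.coslant f g h : k) • B.mapMul (B.mapAct f a.1) (B.mapAct f b.1) x =
        B.mapAct f (B.mapMul a.1 b.1) x
      rw [mapMul_apply (mapHomog_act ha f) (mapHomog_act hb f), mapAct_apply ha,
        mapAct_apply hb, mapAct_apply (mapMul_homog ha hb), mapMul_apply ha hb]
      simp only [map_smul, LinearMap.smul_apply, smul_smul, ← Units.val_mul]
      congr 2
      have h1 := congrArg Additive.ofMul (α.coslant_slant x⁻¹ f g h)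
      apply Additive.ofMul.injective
      simp only [ofMul_mul, ofMul_inv, mul_inv_rev, inv_inv] at h1 ⊢
      linear_combination (norm := abel) -h1)
    (fun f g h a b c ha hb hc => Subtype.ext <| funext fun x => by
      rw [transfer_homog_iff] at ha hb hc
      change B.mapMul a.1 (B.mapMul b.1 c.1) x =
        (α f g h : k) • B.mapMul (B.mapMul a.1 b.1) c.1 x
      rw [mapMul_apply ha (mapMul_homog hb hc), mapMul_apply hb hc,
        mapMul_apply (mapMul_homog ha hb) hc, mapMul_apply ha hb, map_smul,
        ext_mul_assoc (mapHomog_iff.1 ha x) (mapHomog_iff.1 hb x) (mapHomog_iff.1 hc x)]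
      simp only [map_smul, LinearMap.smul_apply, smul_smul, ← Units.val_mul]
      congr 2
      have h1 := congrArg Additive.ofMul (α.coslant_coslant x⁻¹ f g h)
      apply Additive.ofMul.injective
      simp only [ofMul_mul, inv_inv] at h1 ⊢
      linear_combination (norm := abel) -h1)

end

end Transfer

end Obj

/-! ### Twisted group algebras and the algebras `L(H, γ)` -/

/-- Normalised 2-cochains of `G` with values in the multiplicative group of `k`. -/
structure Cochain₂ (G k : Type u) [Group G] [Field k] where
  toFun : G → G → kˣ
  one_left : ∀ g, toFun 1 g = 1
  one_right : ∀ g, toFun g 1 = 1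

namespace Cochain₂

section

variable {G k : Type u} [Group G] [Field k]

instance : CoeFun (Cochain₂ G k) (fun _ => G → G → kˣ) := ⟨Cochain₂.toFun⟩

/-- The differential `(dγ)(f,g,h) = γ(g,h) γ(fg,h)⁻¹ γ(f,gh) γ(f,g)⁻¹`. -/
def d (γ : Cochain₂ G k) (f g h : G) : kˣ :=
  γ g h * (γ (f * g) h)⁻¹ * γ f (g * h) * (γ f g)⁻¹

/-- `ε_f(g) = γ(f,g) / γ(fgf⁻¹,f)`. -/
def eps (γ : Cochain₂ G k) (f g : G) : kˣ := γ f g / γ (f * g * f⁻¹) f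

variable {γ : Cochain₂ G k} {α : Cocycle₃ G k}

lemma d_mul (hγ : γ.d = α) (f g h : G) :
    γ g h * γ f (g * h) = α f g h * (γ f g * γ (f * g) h) := by
  have : α f g h = γ.d f g h := (congrFun (congrFun (congrFun hγ f) g) h).symm
  rw [this, d]
  apply Additive.ofMul.injective
  simp only [ofMul_mul, ofMul_inv]
  abel

lemma eps_mul (hγ : γ.d = α) (f g h : G) :
    γ.eps (f * g) h = α.slant f g h * (γ.eps g h * γ.eps f (g * h * g⁻¹)) := by
  have h1 := congrArg Additive.ofMul (d_mul hγ f g h)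
  have h2 := congrArg Additive.ofMul (d_mul hγ f (g * h * g⁻¹) g)
  have h3 := congrArg Additive.ofMul (d_mul hγ (f * g * h * (f * g)⁻¹) f g)
  apply Additive.ofMul.injective
  simp only [eps, Cocycle₃.slant, ofMul_mul, ofMul_inv, ofMul_div, mul_assoc, mul_inv_rev,
    inv_mul_cancel, mul_one] at *
  linear_combination (norm := abel) h2 - h1 - h3

lemma mul_eps (hγ : γ.d = α) (f g h : G) :
    γ g h * γ.eps f (g * h) =
      α.coslant f g h * (γ.eps f g * γ.eps f h * γ (f * g * f⁻¹) (f * h * f⁻¹)) := by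
  have h1 := congrArg Additive.ofMul (d_mul hγ f g h)
  have h2 := congrArg Additive.ofMul (d_mul hγ (f * g * f⁻¹) f h)
  have h3 := congrArg Additive.ofMul (d_mul hγ (f * g * f⁻¹) (f * h * f⁻¹) f)
  apply Additive.ofMul.injective
  simp only [eps, Cocycle₃.coslant, ofMul_mul, ofMul_inv, ofMul_div, mul_assoc,
    inv_mul_cancel, inv_mul_cancel_left, mul_one] at *
  linear_combination (norm := abel) h1 - h2 + h3

@[simp] lemma eps_one_left (g : G) : γ.eps 1 g = 1 := by
  simp [eps, γ.one_left, γ.one_right]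

@[simp] lemma eps_one_right (g : G) : γ.eps g 1 = 1 := by
  simp [eps, γ.one_left, γ.one_right]

end

variable {α : Cocycle₃ G k} (γ : Cochain₂ G k)

/-- The projection onto the line spanned by `e_g`, in `k[G, γ]`. -/
def algProj (g : G) : Module.End k (G → k) :=
  open scoped Classical in LinearMap.single k (fun _ => k) g ∘ₗ LinearMap.proj g

/-- The basis vector `e_g` of `k[G, γ]`. -/
def e (g : G) : G → k := open scoped Classical in Pi.single g 1

set_option linter.unusedSectionVars false in
lemma algProj_apply (g : G) (v : G → k) : algProj g v = v g • (e g : G → k) := by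
  classical
  simp [algProj, e, ← Pi.single_smul]

lemma algProj_grading : CompleteOrthogonalIdempotents (algProj : G → Module.End k (G → k)) := by
  classical
  rw [CompleteOrthogonalIdempotents.iff_ortho_complete]
  constructor
  · intro g h hgh
    refine LinearMap.ext fun v => ?_
    simp [algProj_apply, e, hgh]
  · refine LinearMap.ext fun v => ?_
    funext x
    simp [algProj_apply, e, Pi.single_apply]

lemma isHomog_e (g : G) : IsHomog algProj g (e g : G → k) := by
  rw [IsHomog, algProj_apply]
  simp [e]

lemma eq_smul_e {g : G} {v : G → k} (hv : IsHomog algProj g v) : v = v g • (e g : G → k) := by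
  rw [← algProj_apply, hv]

/-- The action `h.e_f = ε_h(f) e_{hfh⁻¹}`. -/
def algAct (h : G) : Module.End k (G → k) :=
  ∑ f, (γ.eps h f : k) • (LinearMap.toSpanSingleton k (G → k) (e (h * f * h⁻¹)) ∘ₗ
    LinearMap.proj f)

lemma algAct_e (h f : G) : γ.algAct h (e f) = (γ.eps h f : k) • (e (h * f * h⁻¹) : G → k) := by
  classical
  simp only [algAct, LinearMap.sum_apply, LinearMap.smul_apply, LinearMap.comp_apply,
    LinearMap.proj_apply, LinearMap.toSpanSingleton_apply]
  rw [Finset.sum_eq_single f]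
  · simp [e]
  · intro b _ hb
    simp [e, hb]
  · simp

/-- The product `e_f e_g = γ(f,g) e_{fg}`. -/
def algMul : (G → k) →ₗ[k] (G → k) →ₗ[k] (G → k) :=
  LinearMap.mk₂ k (fun v w => ∑ f, ∑ g, (γ f g * (v f * w g) : k) • (e (f * g) : G → k))
    (fun v v' w => by
      simp only [Pi.add_apply, add_mul, mul_add, add_smul, Finset.sum_add_distrib])
    (fun c v w => by
      simp only [Pi.smul_apply, smul_eq_mul, Finset.smul_sum, smul_smul]
      refine Finset.sum_congr rfl fun f _ => Finset.sum_congr rfl fun g _ => ?_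
      congr 1
      ring)
    (fun v w w' => by
      simp only [Pi.add_apply, mul_add, add_smul, Finset.sum_add_distrib])
    (fun c v w => by
      simp only [Pi.smul_apply, smul_eq_mul, Finset.smul_sum, smul_smul]
      refine Finset.sum_congr rfl fun f _ => Finset.sum_congr rfl fun g _ => ?_
      congr 1
      ring)

lemma algMul_e (f g : G) : γ.algMul (e f) (e g) = (γ f g : k) • (e (f * g) : G → k) := by
  classical
  simp only [algMul, LinearMap.mk₂_apply]
  rw [Finset.sum_eq_single f, Finset.sum_eq_single g]
  · simp [e]
  · intro b _ hb
    simp [e, hb]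
  · simp
  · intro b _ hb
    simp [e, hb]
  · simp

/-- The object `k[G, γ]` of `𝒵(G, α)`, where `dγ = α`. -/
def groupAlgebra (hγ : γ.d = α) : Obj α where
  carrier := G → k
  proj := algProj
  grading := algProj_grading
  act := γ.algAct
  act_one := hext algProj_grading fun g v hv => by
    rw [eq_smul_e hv, map_smul, algAct_e]
    simp
  act_proj f := comm_proj algProj_grading algProj_grading (γ.algAct f) (fun g => f * g * f⁻¹)
    (MulAut.conj f).injective fun g v hv => by
      rw [eq_smul_e hv, map_smul, algAct_e]
      exact ((isHomog_e _).smul _).smul _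
  act_mul f g h v := by
    rw [algProj_apply, map_smul, map_smul, map_smul, algAct_e, algAct_e, map_smul, algAct_e,
      smul_comm (α.slant f g h : k)]
    simp only [smul_smul, ← Units.val_mul, mul_assoc, mul_inv_rev]
    congr 3
    have := eps_mul hγ f g h
    simpa [mul_assoc] using this

/-- The algebra structure on `k[G, γ]`. -/
instance groupAlgebraMonObj (hγ : γ.d = α) : MonObj (γ.groupAlgebra hγ) :=
  Obj.mkMonObj (γ.groupAlgebra hγ) γ.algMul (e 1) (isHomog_e 1)
    (fun f => by
      change γ.algAct f (e 1) = e 1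
      rw [algAct_e]
      simp)
    (LinearMap.congr_fun (f := γ.algMul (e 1)) (g := LinearMap.id)
      (hext algProj_grading fun g v hv => by
        rw [eq_smul_e hv, map_smul, algMul_e]
        simp [γ.one_left]))
    (LinearMap.congr_fun (f := γ.algMul.flip (e 1)) (g := LinearMap.id)
      (hext algProj_grading fun g v hv => by
        rw [eq_smul_e hv, map_smul, LinearMap.flip_apply, algMul_e]
        simp [γ.one_right]))
    (fun f g a b ha hb => by
      change IsHomog algProj (f * g) (γ.algMul a b)
      rw [eq_smul_e ha, eq_smul_e hb, map_smul, LinearMap.map_smul₂, algMul_e]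
      exact (((isHomog_e _).smul _).smul _).smul _)
    (fun f g h a b ha hb => by
      change (α.coslant f g h : k) • γ.algMul (γ.algAct f a) (γ.algAct f b) =
        γ.algAct f (γ.algMul a b)
      rw [eq_smul_e ha, eq_smul_e hb]
      simp only [map_smul, LinearMap.smul_apply, algMul_e, algAct_e, smul_smul]
      have h1 := congrArg Units.val (mul_eps hγ f g h)
      simp only [Units.val_mul] at h1
      have h2 : f * g * f⁻¹ * (f * h * f⁻¹) = f * (g * h) * f⁻¹ := by group
      rw [h2]
      congr 1
      linear_combination -(a g * b h) * h1)
    (fun f g h a b c ha hb hc => by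
      change γ.algMul a (γ.algMul b c) = (α f g h : k) • γ.algMul (γ.algMul a b) c
      rw [eq_smul_e ha, eq_smul_e hb, eq_smul_e hc]
      simp only [map_smul, LinearMap.smul_apply, algMul_e, smul_smul]
      have h1 := congrArg Units.val (d_mul hγ f g h)
      simp only [Units.val_mul] at h1
      rw [← mul_assoc f g h]
      congr 1
      linear_combination (a f * b g * c h) * h1)

end Cochain₂

/-- The algebra `L(H, γ) = E(k[H, γ])` in `𝒵(G, α)`, for a subgroup `H` of `G` and
`γ ∈ C²(H, kˣ)` with `dγ = α|_H`. -/
def lagrangianAlgebra (α : Cocycle₃ G k) (H : Subgroup G) (γ : Cochain₂ H k)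
    (hγ : γ.d = α.restrict H) : Mon (Obj α) :=
  letI : Fintype H := Fintype.ofFinite H
  ⟨(γ.groupAlgebra hγ).transfer⟩

end TwistedCentre

end

/-! Let `L` be Lagrangian. Its component of degree `1` is a nonzero finite-dimensional commutative
`k`-algebra, so it has a character; extended by zero to the other degrees this is a linear form `t`
on `L` (`exists_isDegreeOneChar`). Commutativity forces the form `(z, l) ↦ t (z l)` to have rank at
most one between the degrees `g⁻¹` and `g` (`mul_exchange`, `pairing_eq`). The degrees where the
rank is one form a subgroup `N` (`support`). The radical of the form is an ideal, and the quotient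
has one line in each degree of `N` and nothing elsewhere. Products of these lines are nonzero
(`coeff_vec_mul_vec_ne_zero`), so the structure constants define a cochain `γ`. Associativity of `L`
gives `dγ = α|_N` (`cochain_d`), and commutativity of `L` forces the action of `N` on the quotient
to be that of `k[N, γ]` (`toSupp_act`).

The quotient map is equivariant for `N` only. Coinduction repairs this: `l ↦ (x ↦ [x⁻¹.l])` is a
homomorphism of algebras from `L` to `E(k[N, γ])` (`toTransfer`). The target is commutative
(`transfer_isComm`), hence local as an `L`-module (`RightMod.ofHom_isLocal`), so by hypothesis it is
a direct sum of copies of `L`. The inclusion of one copy is a module map, determined by the image of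
the unit; that image is an invariant of degree `1`, and in `E(k[N, γ])` these are only the scalars
(`exists_eq_smul_unitElt`). Each inclusion is therefore a multiple of the canonical homomorphism.
Since the copies span, that homomorphism is surjective; since there is at least one copy and its
inclusion is split, it is injective (`toTransfer_bijective`). -/

noncomputable section

namespace TwistedCentre

open CategoryTheory MonoidalCategory TensorProduct

namespace Obj

variable {G k : Type u} [Group G] [Fintype G] [Field k] {α : Cocycle₃ G k}

/-! ### Commutativity in terms of homogeneous elements. -/

section Commutative

variable {B : Obj α} [MonObj B]

lemma mulBil_comm [IsCommMonObj B] {f : G} {a : B} (ha : B.Homog f a) (b : B) :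
    B.mulBil a b = B.mulBil (B.act f b) a := by
  have h := LinearMap.congr_fun (congrArg Hom.lin (IsCommMonObj.mul_comm B)) (tm a b)
  exact h.symm.trans (congrArg (Hom.lin (MonObj.mul (X := B))) (braidIso_tm ha b))

/-- An algebra whose product satisfies `ab = (f.b)a` for `a` of degree `f` is commutative. -/
lemma isCommMonObj_of_mulBil
    (h : ∀ f a, B.Homog f a → ∀ g b, B.Homog g b → B.mulBil (B.act f b) a = B.mulBil a b) :
    IsCommMonObj B where
  mul_comm := hom_ext <| tm_ext (X := B) (Y := B) fun f a ha g b hb =>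
    (congrArg (Hom.lin (MonObj.mul (X := B))) (braidIso_tm ha b)).trans (h f a ha g b hb)

/-- Moving `a` past `b` acts on `b` by the degree of `a`, here trivially. This centrality of degree
`1` is what lets a product of dual elements be carried through longer products. -/
lemma mulBil_comm_one [IsCommMonObj B] {a : B} (ha : B.Homog 1 a) (b : B) :
    B.mulBil a b = B.mulBil b a := by
  rw [mulBil_comm ha, B.act_one]
  rfl

lemma eq_zero_of_unitElt_eq_zero (h : B.unitElt = 0) (b : B) : b = 0 := by
  rw [← unitElt_mul b, h, map_zero, LinearMap.zero_apply]

lemma isZero_of_unitElt_eq_zero (h : B.unitElt = 0) : Limits.IsZero B := by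
  rw [Limits.IsZero.iff_id_eq_zero]
  exact hom_ext (LinearMap.ext fun b => eq_zero_of_unitElt_eq_zero h b)

end Commutative

/-! ### The component of degree `1` and its characters. -/

section DegreeOne

variable (B : Obj α)

/-- The component of degree `1`. -/
def degreeOne : Submodule k B := LinearMap.eqLocus (B.proj 1) LinearMap.id

lemma mem_degreeOne {b : B} : b ∈ B.degreeOne ↔ B.Homog 1 b := Iff.rfl

variable [MonObj B]

lemma mul_mem_degreeOne {a b : B} (ha : a ∈ B.degreeOne) (hb : b ∈ B.degreeOne) :
    B.mulBil a b ∈ B.degreeOne := by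
  have := mulBil_homog (mem_degreeOne B |>.1 ha) (mem_degreeOne B |>.1 hb)
  rwa [mul_one] at this

/-- The component of degree `1` of a commutative algebra is a commutative ring. -/
@[reducible] def degreeOneCommRing [IsCommMonObj B] : CommRing B.degreeOne :=
  { (inferInstance : AddCommGroup B.degreeOne) with
    mul := fun a b => ⟨B.mulBil a b, B.mul_mem_degreeOne a.2 b.2⟩
    one := ⟨B.unitElt, unitElt_homog⟩
    left_distrib := fun a b c => Subtype.ext (map_add (B.mulBil a.1) b.1 c.1)
    right_distrib := fun a b c => Subtype.ext (LinearMap.map_add₂ B.mulBil a.1 b.1 c.1)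
    zero_mul := fun a => Subtype.ext (LinearMap.map_zero₂ B.mulBil a.1)
    mul_zero := fun a => Subtype.ext (map_zero (B.mulBil a.1))
    mul_assoc := fun a b c => Subtype.ext <| by
      have := mulBil_assoc a.2 b.2 c.2
      rw [α.one_left, Units.val_one, one_smul] at this
      exact this.symm
    one_mul := fun a => Subtype.ext (unitElt_mul a.1)
    mul_one := fun a => Subtype.ext (mul_unitElt a.1)
    mul_comm := fun a b => Subtype.ext (mulBil_comm_one a.2 b.1) }

/-- A linear form that vanishes outside degree `1` and is an algebra homomorphism on the component
of degree `1`. -/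
structure IsDegreeOneChar (t : B →ₗ[k] k) : Prop where
  map_unit : t B.unitElt = 1
  map_mul : ∀ {a b : B}, B.Homog 1 a → B.Homog 1 b → t (B.mulBil a b) = t a * t b
  map_of_ne : ∀ {g : G} {a : B}, B.Homog g a → g ≠ 1 → t a = 0

/-- The quotient of the degree `1` ring by a maximal ideal is a finite field extension of `k`, so it
maps to the algebraically closed field `k`. Composing with the projection to degree `1` extends the
character by zero. -/
lemma exists_isDegreeOneChar [IsAlgClosed k] [IsCommMonObj B] (hB : B.unitElt ≠ 0) :
    ∃ t, B.IsDegreeOneChar t := by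
  classical
  let : CommRing B.degreeOne := B.degreeOneCommRing
  let : Algebra k B.degreeOne := Algebra.ofModule
    (fun c a b => Subtype.ext (LinearMap.map_smul₂ B.mulBil c a.1 b.1))
    (fun c a b => Subtype.ext (map_smul (B.mulBil a.1) c b.1))
  have : Nontrivial B.degreeOne := ⟨1, 0, fun h => hB (congrArg Subtype.val h)⟩
  obtain ⟨m, hm⟩ := Ideal.exists_maximal B.degreeOne
  let : Field (B.degreeOne ⧸ m) := Ideal.Quotient.field m
  have : Module.Finite k B.degreeOne := FiniteDimensional.finiteDimensional_submodule B.degreeOne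
  have : Module.Finite k (B.degreeOne ⧸ m) :=
    Module.Finite.of_surjective (Ideal.Quotient.mkₐ k m).toLinearMap Ideal.Quotient.mk_surjective
  let χ : B.degreeOne →ₐ[k] k :=
    (IsAlgClosed.lift : (B.degreeOne ⧸ m) →ₐ[k] k).comp (Ideal.Quotient.mkₐ k m)
  let t : B →ₗ[k] k := χ.toLinearMap ∘ₗ
    (B.proj 1).codRestrict B.degreeOne fun b => isHomog_proj B.grading 1 b
  have ht : ∀ {a : B} (ha : B.Homog 1 a), t a = χ ⟨a, ha⟩ := fun {a} ha =>
    congrArg χ (Subtype.ext ha)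
  refine ⟨t, (ht unitElt_homog).trans (map_one χ), fun {a b} ha hb => ?_, fun {g a} ha hg => ?_⟩
  · rw [ht ha, ht hb, ht (B.mul_mem_degreeOne ha hb), ← map_mul]
    rfl
  · refine (congrArg χ (Subtype.ext ?_)).trans (map_zero χ)
    exact (ha.proj_eq B.grading 1).trans (if_neg (Ne.symm hg))

end DegreeOne

/-! ### The form `(z, l) ↦ t (z l)`: its rank and its support. -/

namespace IsDegreeOneChar

variable {B : Obj α} [MonObj B] {t : B →ₗ[k] k}

lemma assoc {f g h : G} {a b c : B} (ha : B.Homog f a) (hb : B.Homog g b)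
    (hc : B.Homog h c) :
    t (B.mulBil a (B.mulBil b c)) = α f g h * t (B.mulBil (B.mulBil a b) c) := by
  rw [mulBil_assoc ha hb hc, map_smul, smul_eq_mul]

/-- Exchanging the outer factors in a product of two elements of degree `1`. -/
lemma mul_exchange [IsCommMonObj B] (ht : B.IsDegreeOneChar t) {g : G} {a b c d : B} (ha : B.Homog g⁻¹ a)
    (hb : B.Homog g b) (hc : B.Homog g⁻¹ c) (hd : B.Homog g d) :
    t (B.mulBil a b) * t (B.mulBil c d) =
      α g g⁻¹ g * (t (B.mulBil b c) * t (B.mulBil a d)) := by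
  have hab : B.Homog 1 (B.mulBil a b) := by simpa using mulBil_homog ha hb
  have hcd : B.Homog 1 (B.mulBil c d) := by simpa using mulBil_homog hc hd
  have hbc : B.Homog 1 (B.mulBil b c) := by simpa using mulBil_homog hb hc
  have had : B.Homog 1 (B.mulBil a d) := by simpa using mulBil_homog ha hd
  rw [← ht.map_mul hab hcd, ← ht.map_mul hbc had]
  -- Regroup `(ab)(cd)` as `a((bc)d)`, then move the central element `bc` past `a` to get
  -- `(bc)(ad)`. Every associator met on the way has an argument `1`, except `α(g, g⁻¹, g)` from
  -- `b(cd) = α(g, g⁻¹, g) (bc)d`.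
  have h1 := mulBil_assoc ha hb hcd
  have h2 := mulBil_assoc ha hbc hd
  have h3 := mulBil_assoc hbc ha hd
  rw [α.one_right, Units.val_one, one_smul] at h1
  rw [α.one_mid, Units.val_one, one_smul] at h2
  rw [α.one_left, Units.val_one, one_smul, mulBil_comm_one hbc a, ← h2] at h3
  rw [← h1, mulBil_assoc hb hc hd, map_smul, map_smul, smul_eq_mul, h3]

/-- The degrees in which the radical of the form `(z, l) ↦ t (z l)` is a proper subspace. -/
def support [IsCommMonObj B] (ht : B.IsDegreeOneChar t) : Subgroup G where
  carrier := {g | ∃ y u, B.Homog g⁻¹ y ∧ B.Homog g u ∧ t (B.mulBil y u) = 1}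
  one_mem' := ⟨B.unitElt, B.unitElt, by simpa using unitElt_homog, unitElt_homog,
    by rw [unitElt_mul, ht.map_unit]⟩
  mul_mem' := by
    rintro g h ⟨y, u, hy, hu, hyu⟩ ⟨z, v, hz, hv, hzv⟩
    have h1 : B.Homog 1 (B.mulBil y u) := by simpa using mulBil_homog hy hu
    have h2 : B.Homog 1 (B.mulBil z v) := by simpa using mulBil_homog hz hv
    -- Since `yu` has degree `1` it commutes with `z`, which turns the argument of `t` into
    -- `(yu)(zv)`.
    have key : t (B.mulBil z (B.mulBil (B.mulBil y u) v)) = 1 := by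
      have e := mulBil_assoc h1 hz hv
      rw [α.one_left, Units.val_one, one_smul, mulBil_comm_one h1 z] at e
      have e' := mulBil_assoc hz h1 hv
      rw [α.one_mid, Units.val_one, one_smul, ← e] at e'
      rw [e', ht.map_mul h1 h2, hyu, hzv, one_mul]
    have e1 := mulBil_assoc hy hu hv
    have e2 := assoc (t := t) hz hy (mulBil_homog hu hv)
    rw [e1, map_smul, map_smul, key, smul_eq_mul, mul_one] at e2
    -- The scalar corrects for the two associators between `z((yu)v)`, where `t` is `1`, and
    -- `(zy)(uv)`.
    refine ⟨((α h⁻¹ g⁻¹ (g * h)) * (α g⁻¹ g h)⁻¹ : kˣ).val • B.mulBil z y, B.mulBil u v,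
      ?_, mulBil_homog hu hv, ?_⟩
    · rw [mul_inv_rev]
      exact (mulBil_homog hz hy).smul _
    · rw [LinearMap.map_smul₂, map_smul, smul_eq_mul, Units.val_mul, mul_right_comm, ← e2,
        Units.mul_inv]
  inv_mem' := by
    rintro g ⟨y, u, hy, hu, hyu⟩
    -- With both pairs equal to `(y, u)` the exchange reads `1 = α(g, g⁻¹, g) t(uy)`, which gives
    -- the normalising scalar for the swapped pair.
    have h := ht.mul_exchange hy hu hy hu
    rw [hyu, mul_one, mul_one] at h
    refine ⟨(α g g⁻¹ g : k) • u, y, ?_, hy, ?_⟩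
    · rw [inv_inv]
      exact hu.smul _
    · rw [LinearMap.map_smul₂, map_smul, smul_eq_mul, ← h]

variable [IsCommMonObj B] (ht : B.IsDegreeOneChar t)

/-- Dual elements in degrees `g⁻¹` and `g`, equal to the unit for `g = 1`. -/
lemma exists_dual (n : ht.support) : ∃ p : B × B, B.Homog (n : G)⁻¹ p.1 ∧ B.Homog (n : G) p.2 ∧
    t (B.mulBil p.1 p.2) = 1 ∧ (n = 1 → p.1 = B.unitElt ∧ p.2 = B.unitElt) := by
  by_cases hn : n = 1
  · subst hn
    exact ⟨(B.unitElt, B.unitElt), by simpa using unitElt_homog, by simpa using unitElt_homog,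
      by simp [unitElt_mul, ht.map_unit], fun _ => ⟨rfl, rfl⟩⟩
  · obtain ⟨y, u, hy, hu, h⟩ := n.2
    exact ⟨(y, u), hy, hu, h, fun e => absurd e hn⟩

/-- The chosen element of degree `n`. -/
def vec (n : ht.support) : B := (ht.exists_dual n).choose.2

/-- The chosen element of degree `n⁻¹`, dual to `vec n`. -/
def covec (n : ht.support) : B := (ht.exists_dual n).choose.1

lemma covec_homog (n : ht.support) : B.Homog (n : G)⁻¹ (ht.covec n) :=
  (ht.exists_dual n).choose_spec.1

lemma vec_homog (n : ht.support) : B.Homog (n : G) (ht.vec n) :=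
  (ht.exists_dual n).choose_spec.2.1

lemma covec_vec (n : ht.support) : t (B.mulBil (ht.covec n) (ht.vec n)) = 1 :=
  (ht.exists_dual n).choose_spec.2.2.1

lemma covec_one : ht.covec 1 = B.unitElt := ((ht.exists_dual 1).choose_spec.2.2.2 rfl).1

lemma vec_one : ht.vec 1 = B.unitElt := ((ht.exists_dual 1).choose_spec.2.2.2 rfl).2

/-- Modulo the radical, the component of degree `n` is spanned by `vec n`. -/
lemma pairing_eq (n : ht.support) {z l : B} (hz : B.Homog (n : G)⁻¹ z) (hl : B.Homog (n : G) l) :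
    t (B.mulBil z l) = t (B.mulBil (ht.covec n) l) * t (B.mulBil z (ht.vec n)) := by
  -- Both exchanges produce the factor `α(n, n⁻¹, n) t(l · covec n)`; the second identifies it with
  -- `t(covec n · l)`.
  have h1 := ht.mul_exchange hz hl (ht.covec_homog n) (ht.vec_homog n)
  have h2 := ht.mul_exchange (ht.covec_homog n) hl (ht.covec_homog n) (ht.vec_homog n)
  rw [ht.covec_vec, mul_one] at h1 h2
  rw [mul_one] at h2
  rw [h1, h2]
  ring

/-- A nonzero value could be rescaled to `1`, which would put `g` in the support. -/
lemma pairing_eq_zero {g : G} (hg : g ∉ ht.support) {z l : B} (hz : B.Homog g⁻¹ z)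
    (hl : B.Homog g l) : t (B.mulBil z l) = 0 := by
  by_contra h
  refine hg ⟨(t (B.mulBil z l))⁻¹ • z, l, hz.smul _, hl, ?_⟩
  rw [LinearMap.map_smul₂, map_smul, smul_eq_mul, inv_mul_cancel₀ h]

/-! ### The quotient by the radical and its structure constants. -/

/-- The coefficient of `vec n`. -/
def coeff (n : ht.support) : B →ₗ[k] k := t ∘ₗ B.mulBil (ht.covec n)

lemma coeff_apply (n : ht.support) (l : B) : ht.coeff n l = t (B.mulBil (ht.covec n) l) := rfl

lemma coeff_of_ne {n : ht.support} {g : G} {l : B} (hl : B.Homog g l) (h : (n : G) ≠ g) :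
    ht.coeff n l = 0 := by
  refine ht.map_of_ne (mulBil_homog (ht.covec_homog n) hl) fun e => h ?_
  rwa [inv_mul_eq_one] at e

@[simp] lemma coeff_vec (n : ht.support) : ht.coeff n (ht.vec n) = 1 := ht.covec_vec n

/-- The radical is an ideal. -/
lemma coeff_mul_of_right_radical {n : ht.support} {f g : G} {l l' : B} (hn : (n : G) = f * g)
    (hl : B.Homog f l) (hl' : B.Homog g l')
    (h : ∀ z, B.Homog g⁻¹ z → t (B.mulBil z l') = 0) : ht.coeff n (B.mulBil l l') = 0 := by
  rw [coeff_apply, assoc (ht.covec_homog n) hl hl', h, mul_zero]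
  have := mulBil_homog (ht.covec_homog n) hl
  rw [hn] at this
  simpa using this

/-- Commutativity writes `l l'` as `(f.l') l`, which puts the radical factor on the right. -/
lemma coeff_mul_of_left_radical {n : ht.support} {f g : G} {l l' : B} (hn : (n : G) = f * g)
    (hl : B.Homog f l) (hl' : B.Homog g l')
    (h : ∀ z, B.Homog f⁻¹ z → t (B.mulBil z l) = 0) : ht.coeff n (B.mulBil l l') = 0 := by
  rw [mulBil_comm hl]
  exact ht.coeff_mul_of_right_radical (by simp [hn]) (hl'.act f) hl h

lemma coeff_mul_eq_zero_of_notMem {n : ht.support} {f g : G} {l l' : B}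
    (hl : B.Homog f l) (hl' : B.Homog g l') (h : f ∉ ht.support ∨ g ∉ ht.support) :
    ht.coeff n (B.mulBil l l') = 0 := by
  by_cases hn : (n : G) = f * g
  · obtain h | h := h
    · exact ht.coeff_mul_of_left_radical hn hl hl' fun z hz => ht.pairing_eq_zero h hz hl
    · exact ht.coeff_mul_of_right_radical hn hl hl' fun z hz => ht.pairing_eq_zero h hz hl'
  · exact ht.coeff_of_ne (mulBil_homog hl hl') hn

/-- By the rank one identity `pairing_eq`, `l` differs from its multiple of `vec n` by an element of
the radical. -/
lemma pairing_sub (n : ht.support) {l : B} (hl : B.Homog (n : G) l) {z : B}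
    (hz : B.Homog (n : G)⁻¹ z) : t (B.mulBil z (l - ht.coeff n l • ht.vec n)) = 0 := by
  rw [map_sub, map_sub, map_smul, map_smul, ht.pairing_eq n hz hl, smul_eq_mul, coeff_apply,
    sub_self]

lemma homog_sub (n : ht.support) {l : B} (hl : B.Homog (n : G) l) :
    B.Homog (n : G) (l - ht.coeff n l • ht.vec n) := by
  rw [Homog, IsHomog, map_sub, hl, ((ht.vec_homog n).smul _)]

/-- Because the radical is an ideal, each factor may be replaced by its multiple of `vec`, the right
one in `h1` and then the left one in `h2`. Hence the product descends to the quotient. -/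
lemma coeff_mul (m n : ht.support) {l l' : B} (hl : B.Homog (m : G) l)
    (hl' : B.Homog (n : G) l') : ht.coeff (m * n) (B.mulBil l l') =
      ht.coeff (m * n) (B.mulBil (ht.vec m) (ht.vec n)) * (ht.coeff m l * ht.coeff n l') := by
  have h1 := ht.coeff_mul_of_right_radical (n := m * n) rfl hl (ht.homog_sub n hl')
    (fun z hz => ht.pairing_sub n hl' hz)
  have h2 := ht.coeff_mul_of_left_radical (n := m * n) rfl (ht.homog_sub m hl) (ht.vec_homog n)
    (fun z hz => ht.pairing_sub m hl hz)
  rw [map_sub, map_smul, map_sub, map_smul, smul_eq_mul, sub_eq_zero] at h1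
  rw [LinearMap.map_sub₂, LinearMap.map_smul₂, map_sub, map_smul, smul_eq_mul, sub_eq_zero] at h2
  rw [h1, h2]
  ring

/-- Were the coefficient zero, `vec m · vec n` would lie in the radical and pair to zero with `covec
n · covec m`. Up to associators this pairing is `t` of `(covec m · vec m)(covec n · vec n)`, which
is `1`. This makes the structure constants units. -/
lemma coeff_vec_mul_vec_ne_zero (m n : ht.support) :
    ht.coeff (m * n) (B.mulBil (ht.vec m) (ht.vec n)) ≠ 0 := by
  intro h
  have hm := ht.covec_homog m
  have hn := ht.covec_homog n
  have h1 : B.Homog 1 (B.mulBil (ht.covec m) (ht.vec m)) := by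
    simpa using mulBil_homog hm (ht.vec_homog m)
  have h2 : B.Homog 1 (B.mulBil (ht.covec n) (ht.vec n)) := by
    simpa using mulBil_homog hn (ht.vec_homog n)
  have hmn := mulBil_homog (ht.vec_homog m) (ht.vec_homog n)
  have e0 := ht.pairing_eq (m * n) (z := B.mulBil (ht.covec n) (ht.covec m))
    (by simpa using mulBil_homog hn hm) hmn
  rw [← coeff_apply, h, zero_mul] at e0
  -- Brings together `covec m` and `vec m`, whose product has degree `1` and can be moved in front
  -- of `covec n`.
  have e1 := assoc (t := t) hn hm hmn
  rw [e0, mul_zero, mulBil_assoc hm (ht.vec_homog m) (ht.vec_homog n), map_smul, map_smul,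
    smul_eq_mul, assoc hn h1 (ht.vec_homog n), ← mulBil_comm_one h1] at e1
  have e2 := assoc (t := t) h1 hn (ht.vec_homog n)
  rw [ht.map_mul h1 h2, ht.covec_vec, ht.covec_vec] at e2
  simp [α.one_left, α.one_mid] at e1 e2
  rw [e1] at e2
  exact one_ne_zero e2

/-- The 2-cochain of structure constants with respect to the elements `vec n`. -/
def cochain : Cochain₂ ht.support k where
  toFun m n := Units.mk0 _ (ht.coeff_vec_mul_vec_ne_zero m n)
  one_left n := Units.ext <| by
    change ht.coeff (1 * n) _ = 1
    rw [one_mul, vec_one, unitElt_mul, coeff_vec]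
  one_right n := Units.ext <| by
    change ht.coeff (n * 1) _ = 1
    rw [mul_one, vec_one, mul_unitElt, coeff_vec]

lemma coeff_mul_eq (m n : ht.support) {l l' : B} (hl : B.Homog (m : G) l)
    (hl' : B.Homog (n : G) l') : ht.coeff (m * n) (B.mulBil l l') =
      ht.cochain m n * (ht.coeff m l * ht.coeff n l') := ht.coeff_mul m n hl hl'

/-- Take the coefficient in degree `fgh` of the `α`-associativity of `vec f`, `vec g`, `vec h`: both
bracketings become products of two values of the cochain. -/
lemma cochain_d : ht.cochain.d = α.restrict ht.support := by
  funext f g h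
  have hf := ht.vec_homog f
  have hg := ht.vec_homog g
  have hh := ht.vec_homog h
  have e := congrArg (ht.coeff (f * g * h)) (mulBil_assoc hf hg hh)
  rw [map_smul, ht.coeff_mul_eq (f * g) h (mulBil_homog hf hg) hh, ht.coeff_mul_eq f g hf hg,
    _root_.mul_assoc, ht.coeff_mul_eq f (g * h) hf (mulBil_homog hg hh),
    ht.coeff_mul_eq g h hg hh] at e
  simp only [coeff_vec, mul_one, one_mul, smul_eq_mul, ← Units.val_mul] at e
  have e' := Units.ext e
  change ht.cochain.d f g h = α f g h
  rw [Cochain₂.d, mul_inv_eq_iff_eq_mul, mul_right_comm, mul_inv_eq_iff_eq_mul,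
    mul_comm (ht.cochain g h), e']
  ac_rfl

end IsDegreeOneChar

end Obj

/-! ### Modules obtained from homomorphisms of algebras. -/

section RestrictScalars

variable {C : Type*} [Category C] [MonoidalCategory C] {A B : C} [MonObj A] [MonObj B]

open MonObj

/-- An algebra `B` as a right module over `A`, by a homomorphism of algebras `A ⟶ B`. -/
def RightMod.ofHom (φ : A ⟶ B) [IsMonHom φ] : RightMod A where
  X := B
  act := B ◁ φ ≫ μ[B]
  act_one := by
    rw [← MonoidalCategory.whiskerLeft_comp_assoc, IsMonHom.one_hom, MonObj.mul_one]
  act_act := by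
    rw [← MonoidalCategory.whiskerLeft_comp_assoc, IsMonHom.mul_hom,
      MonoidalCategory.tensorHom_def]
    simp only [comp_whiskerRight, MonoidalCategory.whiskerLeft_comp, Category.assoc]
    rw [← whisker_exchange_assoc, MonObj.mul_assoc]
    simp

/-- Naturality slides `φ` through both braidings, after which commutativity of `B` absorbs each
braiding into the product. -/
lemma RightMod.ofHom_isLocal [BraidedCategory C] [IsCommMonObj B] (φ : A ⟶ B) [IsMonHom φ] :
    (RightMod.ofHom φ).IsLocal := by
  change (β_ B A).hom ≫ (β_ A B).hom ≫ B ◁ φ ≫ μ[B] = B ◁ φ ≫ μ[B]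
  rw [← BraidedCategory.braiding_naturality_left_assoc, IsCommMonObj.mul_comm,
    ← BraidedCategory.braiding_naturality_right_assoc, IsCommMonObj.mul_comm]

end RestrictScalars

/-! ### Commutativity of `k[G, γ]`. -/

namespace Cochain₂

variable {G k : Type u} [Group G] [Fintype G] [Field k] {α : Cocycle₃ G k}

/-- The basis vector `e_g`, as an element of the object `k[G, γ]`. -/
def basisElt {γ : Cochain₂ G k} (hγ : γ.d = α) (g : G) : γ.groupAlgebra hγ := (e g : G → k)

lemma mulBil_basisElt {γ : Cochain₂ G k} (hγ : γ.d = α) (f g : G) :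
    (γ.groupAlgebra hγ).mulBil (basisElt hγ f) (basisElt hγ g) =
      (γ f g : k) • basisElt hγ (f * g) :=
  γ.algMul_e f g

lemma act_basisElt {γ : Cochain₂ G k} (hγ : γ.d = α) (f g : G) :
    (γ.groupAlgebra hγ).act f (basisElt hγ g) = (γ.eps f g : k) • basisElt hγ (f * g * f⁻¹) :=
  γ.algAct_e f g

lemma basisElt_homog {γ : Cochain₂ G k} (hγ : γ.d = α) (g : G) :
    (γ.groupAlgebra hγ).Homog g (basisElt hγ g) :=
  isHomog_e g

lemma unitElt_eq_basisElt {γ : Cochain₂ G k} (hγ : γ.d = α) :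
    (γ.groupAlgebra hγ).unitElt = basisElt hγ 1 :=
  one_smul k (basisElt hγ 1)

lemma exists_eq_smul_basisElt {γ : Cochain₂ G k} (hγ : γ.d = α) {g : G} {v : γ.groupAlgebra hγ}
    (hv : (γ.groupAlgebra hγ).Homog g v) : ∃ c : k, v = c • basisElt hγ g :=
  ⟨_, eq_smul_e hv⟩

lemma basisElt_ne_zero {γ : Cochain₂ G k} (hγ : γ.d = α) (g : G) : basisElt hγ g ≠ 0 := by
  classical
  intro h
  have := congrFun (show (e g : G → k) = 0 from h) g
  simp [e] at this

/-- The factor `γ(f,g) / γ(fgf⁻¹,f)` in the action is exactly the one that makes `(f.e_g) e_f` equal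
to `e_f e_g`. -/
instance groupAlgebra_isComm {γ : Cochain₂ G k} (hγ : γ.d = α) :
    IsCommMonObj (γ.groupAlgebra hγ) :=
  Obj.isCommMonObj_of_mulBil fun f a ha g b hb => by
    obtain ⟨c, rfl⟩ := exists_eq_smul_basisElt hγ ha
    obtain ⟨d, rfl⟩ := exists_eq_smul_basisElt hγ hb
    simp only [map_smul, LinearMap.smul_apply, act_basisElt, mulBil_basisElt, smul_smul,
      inv_mul_cancel_right]
    rw [_root_.mul_assoc d, ← Units.val_mul, eps, div_mul_cancel, mul_left_comm]

end Cochain₂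

namespace Obj

variable {G k : Type u} [Group G] [Fintype G] [Field k] {α : Cocycle₃ G k}

/-! ### Invariants and commutativity of `E(B)`. -/

section TransferComm

variable {H : Subgroup G} [Fintype H] {B : Obj (α.restrict H)}

lemma transfer_act_val (g : G) (a : B.transfer) : (B.transfer.act g a).1 = B.mapAct g a.1 := rfl

/-- A homogeneous invariant of degree `1` in a transfer is a constant map. -/
lemma transfer_eq_const {a : B.transfer} (ha : B.transfer.Homog 1 a)
    (hinv : ∀ g, B.transfer.act g a = a) (x : G) : a.1 x = a.1 1 := by
  -- Evaluating `x.a` at the point `x` itself gives `a(1)`; the slant factor is trivial in degree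
  -- `1`.
  have h := congrFun (congrArg Subtype.val (hinv x)) x
  rw [transfer_act_val, mapAct_apply (show IsHomog B.mapProj 1 a.1 from Subtype.ext_iff.1 ha)] at h
  simpa using h.symm

variable [MonObj B]

lemma transfer_mulBil_val (a b : B.transfer) : (B.transfer.mulBil a b).1 = B.mapMul a.1 b.1 := rfl

lemma transfer_unitElt_val : B.transfer.unitElt.1 = fun _ => B.unitElt := by
  change (1 : k) • (fun _ : G => B.unitElt) = _
  rw [one_smul]

lemma transfer_unitElt_ne_zero (h : B.unitElt ≠ 0) : B.transfer.unitElt ≠ 0 := fun e =>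
  h (congrFun (transfer_unitElt_val.symm.trans (congrArg Subtype.val e)) 1)

/-- The transfer of a commutative algebra is commutative. -/
instance transfer_isComm [IsCommMonObj B] : IsCommMonObj B.transfer :=
  isCommMonObj_of_mulBil fun f a ha g b hb => Subtype.ext <| funext fun x => by
    rw [transfer_homog_iff] at ha hb
    rw [transfer_mulBil_val, transfer_mulBil_val, transfer_act_val,
      mapMul_apply (mapHomog_act hb f) ha, mapMul_apply ha hb, mapAct_apply hb]
    obtain h0 | ⟨n, hn, hax⟩ := (mapHomog_iff.1 ha x).cases
    · simp [h0]
    -- Where `a(x)` is nonzero, its degree `n = x⁻¹fx` lies in `H`. The value of `f.b` at `x`, a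
    -- multiple of `b(f⁻¹x) = b(xn⁻¹)`, is then a multiple of `n.b(x)` by equivariance, so
    -- commutativity of `B` applies pointwise.
    have hx : f⁻¹ * x = x * (n⁻¹ : H) := by
      rw [InvMemClass.coe_inv, hn]
      group
    rw [hx, (mem_transfer_iff hb).1 b.2, mulBil_comm hax, inv_inv]
    simp only [map_smul, LinearMap.smul_apply, smul_smul, ← Units.val_mul]
    congr 2
    have h := α.coslant_mul_slant x⁻¹ f g
    rw [inv_inv] at h
    rw [InvMemClass.coe_inv, inv_inv, hn, mul_left_comm, inv_mul_eq_iff_eq_mul,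
      mul_comm (α.slant x⁻¹ f g), h]

end TransferComm

/-! ### The homomorphism from `B` to `E(k[N, γ])`. -/

namespace IsDegreeOneChar

variable {B : Obj α} [MonObj B] [IsCommMonObj B] {t : B →ₗ[k] k} (ht : B.IsDegreeOneChar t)
  [Fintype ht.support]

/-- The algebra `k[N, γ]` for the support `N` and the cochain `γ` of structure constants. -/
abbrev suppAlgebra : Obj (α.restrict ht.support) := ht.cochain.groupAlgebra ht.cochain_d

/-- The projection onto the quotient by the radical, `k[N, γ]`. -/
def toSupp : B →ₗ[k] ht.suppAlgebra := LinearMap.pi ht.coeff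

lemma toSupp_eq {n : ht.support} {l : B} (hl : B.Homog (n : G) l) :
    ht.toSupp l = ht.coeff n l • Cochain₂.basisElt ht.cochain_d n := by
  classical
  refine funext (α := ht.support) (β := fun _ => k) fun m => ?_
  change ht.coeff m l = ht.coeff n l * (Cochain₂.e n : ht.support → k) m
  by_cases h : m = n
  · simp [h, Cochain₂.e]
  · rw [ht.coeff_of_ne hl (fun e => h (Subtype.ext e))]
    simp [Cochain₂.e, h]

lemma toSupp_of_notMem {g : G} (hg : g ∉ ht.support) {l : B} (hl : B.Homog g l) :
    ht.toSupp l = 0 :=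
  funext (α := ht.support) (β := fun _ => k) fun m =>
    ht.coeff_of_ne hl fun (e : (m : G) = g) => hg (e ▸ m.2)

lemma toSupp_homog {g : G} {l : B} (hl : B.Homog g l) : ht.suppAlgebra.ExtHomog g (ht.toSupp l) := by
  by_cases hg : g ∈ ht.support
  · lift g to ht.support using hg
    rw [ht.toSupp_eq hl]
    exact (Homog.ext (Cochain₂.basisElt_homog ht.cochain_d g)).smul _
  · rw [ht.toSupp_of_notMem hg hl]
    exact IsHomog.zero _ _

lemma toSupp_unitElt : ht.toSupp B.unitElt = ht.suppAlgebra.unitElt := by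
  rw [ht.toSupp_eq (n := 1) unitElt_homog, coeff_apply, ht.covec_one, unitElt_mul, ht.map_unit, one_smul,
    Cochain₂.unitElt_eq_basisElt]

/-- If a factor has degree outside the support, it is in the radical and so is the product;
otherwise this is the definition of the cochain by structure constants. -/
lemma toSupp_mul {f g : G} {a b : B} (ha : B.Homog f a) (hb : B.Homog g b) :
    ht.toSupp (B.mulBil a b) = ht.suppAlgebra.mulBil (ht.toSupp a) (ht.toSupp b) := by
  by_cases h : f ∉ ht.support ∨ g ∉ ht.support
  · have h0 : ht.toSupp (B.mulBil a b) = 0 :=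
      funext (α := ht.support) (β := fun _ => k) fun n => ht.coeff_mul_eq_zero_of_notMem ha hb h
    rw [h0]
    obtain h | h := h
    · rw [ht.toSupp_of_notMem h ha, LinearMap.map_zero₂]
    · rw [ht.toSupp_of_notMem h hb, map_zero]
  · push Not at h
    obtain ⟨hf, hg⟩ := h
    lift f to ht.support using hf
    lift g to ht.support using hg
    rw [ht.toSupp_eq ha, ht.toSupp_eq hb, ht.toSupp_eq (n := f * g) (mulBil_homog ha hb),
      ht.coeff_mul_eq f g ha hb, map_smul, LinearMap.map_smul₂,
      Cochain₂.mulBil_basisElt, smul_smul, smul_smul]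
    congr 1
    ring

/-- The action is determined by commutativity: comparing the coefficients of `vec h · a` and of the
equal product `(h.a) · vec h` gives the factor `γ(h,g) / γ(hgh⁻¹,h)`, which is `eps`. -/
lemma toSupp_act {g : G} {a : B} (ha : B.Homog g a) (h : ht.support) :
    ht.toSupp (B.act h a) = ht.suppAlgebra.act h (ht.toSupp a) := by
  by_cases hg : g ∈ ht.support
  · lift g to ht.support using hg
    rw [ht.toSupp_eq ha, ht.toSupp_eq (n := h * g * h⁻¹) (ha.act h), map_smul,
      Cochain₂.act_basisElt, smul_smul]
    congr 1
    have e1 := ht.coeff_mul_eq h g (ht.vec_homog h) ha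
    have e2 := ht.coeff_mul_eq (h * g * h⁻¹) h (ha.act h) (ht.vec_homog h)
    rw [inv_mul_cancel_right, ← mulBil_comm (ht.vec_homog h), e1] at e2
    simp only [coeff_vec, _root_.one_mul, _root_.mul_one] at e2
    rw [Cochain₂.eps, Units.val_div_eq_div_val, ← mul_div_assoc, eq_div_iff (Units.ne_zero _)]
    linear_combination -e2
  · rw [ht.toSupp_of_notMem hg ha, map_zero]
    -- Conjugation by `h` in the support preserves the complement of the support, so both sides
    -- vanish.
    refine ht.toSupp_of_notMem (fun h' => hg ?_) (ha.act h)
    have := mul_mem (mul_mem (inv_mem h.2) h') h.2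
    simpa [mul_assoc] using this

/-- The map `l ↦ (x ↦ [x⁻¹.l])` to the functions on `G`. -/
def toMap : B →ₗ[k] (G → ht.suppAlgebra) := LinearMap.pi fun x => ht.toSupp ∘ₗ B.act x⁻¹

lemma toMap_apply (l : B) (x : G) : ht.toMap l x = ht.toSupp (B.act x⁻¹ l) := rfl

lemma toMap_homog {f : G} {l : B} (hl : B.Homog f l) :
    IsHomog ht.suppAlgebra.mapProj f (ht.toMap l) := by
  rw [mapHomog_iff]
  intro x
  have := ht.toSupp_homog (hl.act x⁻¹)
  rwa [inv_inv] at this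

/-- The transformation rule of `E` under the support is the equivariance `toSupp_act`, with the
slant factor coming from `(h⁻¹x⁻¹).l`. -/
lemma toMap_mem (l : B) : ht.toMap l ∈ ht.suppAlgebra.transferSubmodule := by
  rw [← sum_proj B.grading l, map_sum]
  refine Submodule.sum_mem _ fun f _ => ?_
  have hl := isHomog_proj B.grading f l
  rw [mem_transfer_iff (ht.toMap_homog hl)]
  intro x h
  rw [toMap_apply, toMap_apply, mul_inv_rev, hl.act_mul, map_smul, ← ht.toSupp_act (hl.act x⁻¹)]
  rfl

/-- The morphism from an algebra `B` to `E(k[N, γ])` attached to a character of the component of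
degree `1` of `B`. -/
def toTransfer : B ⟶ ht.suppAlgebra.transfer :=
  mkHom (ht.toMap.codRestrict _ ht.toMap_mem)
    (fun _ _ hl => transfer_homog_iff.2 (ht.toMap_homog hl))
    (fun f g l hl => Subtype.ext <| funext fun x => by
      change ht.toMap (B.act f l) x = ht.suppAlgebra.mapAct f (ht.toMap l) x
      rw [mapAct_apply (ht.toMap_homog hl), toMap_apply, toMap_apply, mul_inv_rev, inv_inv,
        hl.act_mul, map_smul, smul_smul, Units.inv_mul, one_smul])

/-- Letting `x⁻¹` act on `ab` produces `α(x⁻¹|f,g)`, the factor built into the product of `E`;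
pointwise, multiplicativity is then that of `toSupp`. -/
instance toTransfer_isMonHom : IsMonHom ht.toTransfer where
  one_hom := hom_ext <| LinearMap.ext_ring <| Subtype.ext <| funext fun x => by
    change ht.toMap B.unitElt x = ht.suppAlgebra.transfer.unitElt.1 x
    rw [transfer_unitElt_val, toMap_apply, act_unitElt, toSupp_unitElt]
  mul_hom := hom_ext <| tm_ext (X := B) (Y := B) fun f a ha g b hb =>
    Subtype.ext <| funext fun x => by
      change ht.toMap (B.mulBil a b) x =
        ht.suppAlgebra.mapMul (ht.toMap a) (ht.toMap b) x
      rw [mapMul_apply (ht.toMap_homog ha) (ht.toMap_homog hb), toMap_apply, act_mulBil ha hb,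
        map_smul, ht.toSupp_mul (ha.act _) (hb.act _)]
      rfl

end IsDegreeOneChar

end Obj

/-! ### Bijectivity of the homomorphism for a Lagrangian algebra. -/

namespace Obj

namespace IsDegreeOneChar

variable {G k : Type u} [Group G] [Fintype G] [Field k] {α : Cocycle₃ G k}
  {B : Obj α} [MonObj B] [IsCommMonObj B] {t : B →ₗ[k] k} (ht : B.IsDegreeOneChar t)
  [Fintype ht.support]

lemma suppAlgebra_unitElt_ne_zero : ht.suppAlgebra.unitElt ≠ 0 := by
  rw [Cochain₂.unitElt_eq_basisElt]
  exact Cochain₂.basisElt_ne_zero _ _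

/-- The invariants of degree `1` in `E(k[N, γ])` are the multiples of the unit. -/
lemma exists_eq_smul_unitElt {a : ht.suppAlgebra.transfer}
    (ha : ht.suppAlgebra.transfer.Homog 1 a) (hinv : ∀ g, ht.suppAlgebra.transfer.act g a = a) :
    ∃ c : k, a = c • ht.suppAlgebra.transfer.unitElt := by
  -- The value at `1` has degree `1` in `k[N, γ]`, hence lies on the line of the unit;
  -- `transfer_eq_const` then spreads it to all points.
  have h1 := mapHomog_iff.1 (transfer_homog_iff.1 ha) 1
  simp only [inv_one, mul_one] at h1
  have h2 : ht.suppAlgebra.Homog 1 (a.1 1) := by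
    rw [Homog, IsHomog, ← extProj_coe]
    exact h1
  obtain ⟨c, hc⟩ := Cochain₂.exists_eq_smul_basisElt ht.cochain_d h2
  refine ⟨c, Subtype.ext (funext fun x => ?_)⟩
  change a.1 x = c • ht.suppAlgebra.transfer.unitElt.1 x
  rw [transfer_eq_const ha hinv, hc, transfer_unitElt_val, Cochain₂.unitElt_eq_basisElt]

/-- A homomorphism of modules from `B` to `E(k[N, γ])` is a multiple of the canonical one. -/
lemma exists_eq_smul_toTransfer (φ : B ⟶ ht.suppAlgebra.transfer)
    (hφ : RightMod.IsModHom (RightMod.regular B) (RightMod.ofHom ht.toTransfer) φ) :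
    ∃ c : k, ∀ b, Hom.lin φ b = c • Hom.lin ht.toTransfer b := by
  -- The image of the unit is invariant of degree `1`, so it is a scalar `c`; linearity over `B`
  -- then gives `φ(b) = φ(1) · b` for the module action.
  obtain ⟨c, hc⟩ := ht.exists_eq_smul_unitElt (map_homog φ unitElt_homog) fun g => by
    rw [← Hom.map_act φ, act_unitElt]
  refine ⟨c, fun b => ?_⟩
  have h : Hom.lin φ (B.mulBil B.unitElt b) =
      ht.suppAlgebra.transfer.mulBil (Hom.lin φ B.unitElt) (Hom.lin ht.toTransfer b) :=
    LinearMap.congr_fun (congrArg Hom.lin hφ) (tm B.unitElt b)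
  rwa [unitElt_mul, hc, LinearMap.map_smul₂, unitElt_mul] at h

/-- The target, a local `B`-module through `toTransfer`, splits into copies of `B`, and every
inclusion `i j` is a multiple `c j` of `toTransfer`. -/
lemma toTransfer_bijective (hB : IsLagrangian B) :
    Function.Bijective (Hom.lin ht.toTransfer) := by
  obtain ⟨n, i, p, hi, hip, hsum⟩ : ∃ (n : ℕ) (i : Fin n → (B ⟶ ht.suppAlgebra.transfer))
      (p : Fin n → (ht.suppAlgebra.transfer ⟶ B)),
      (∀ j, RightMod.IsModHom (RightMod.regular B) (RightMod.ofHom ht.toTransfer) (i j)) ∧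
      (∀ j, i j ≫ p j = 𝟙 B) ∧ ∑ j, p j ≫ i j = 𝟙 ht.suppAlgebra.transfer := by
    obtain ⟨n, i, p, hi, -, hip, -, hsum⟩ := hB.free _ (RightMod.ofHom_isLocal ht.toTransfer)
    exact ⟨n, i, p, hi, hip, hsum⟩
  choose c hc using fun j => ht.exists_eq_smul_toTransfer (i j) (hi j)
  have hs : ∀ a : ht.suppAlgebra.transfer, ∑ j, Hom.lin (i j) (Hom.lin (p j) a) = a := by
    intro a
    let ev : (ht.suppAlgebra.transfer ⟶ ht.suppAlgebra.transfer) →+ ht.suppAlgebra.transfer :=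
      { toFun := fun ψ => Hom.lin ψ a
        map_zero' := rfl
        map_add' := fun _ _ => rfl }
    exact (map_sum ev (fun j => p j ≫ i j) Finset.univ).symm.trans (congrArg ev hsum)
  constructor
  -- With no copies the target would be zero, contradicting its nonzero unit. For any `j`, equal
  -- values of `toTransfer` give equal values of `i j`, and `p j` is a retraction of `i j`.
  · have hn : Nonempty (Fin n) := by
      by_contra h
      rw [not_nonempty_iff] at h
      refine transfer_unitElt_ne_zero ht.suppAlgebra_unitElt_ne_zero ?_
      rw [← hs (ht.suppAlgebra.transfer.unitElt), Fintype.sum_empty]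
    obtain ⟨j⟩ := hn
    intro a b hab
    have h : Hom.lin (i j) a = Hom.lin (i j) b := by rw [hc, hc, hab]
    have h' : ∀ b : B, Hom.lin (p j) (Hom.lin (i j) b) = b :=
      LinearMap.congr_fun (congrArg Hom.lin (hip j))
    rw [← h' a, h, h']
  · intro a
    -- `toTransfer` sends the `j`-th term to `i j (p j a)`, and these add up to `a`.
    refine ⟨∑ j, c j • Hom.lin (p j) a, ?_⟩
    rw [map_sum]
    refine Eq.trans (Finset.sum_congr rfl fun j _ => ?_) (hs a)
    rw [map_smul, hc]

end IsDegreeOneChar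

end Obj

end TwistedCentre

end

theorem mainTheorem1 {k G : Type u} [Field k] [IsAlgClosed k] [CharZero k] [Group G] [Fintype G]
    (α : TwistedCentre.Cocycle₃ G k) (L : CategoryTheory.Mon (TwistedCentre.Obj α))
    (hL : TwistedCentre.IsLagrangian L.X) :
    ∃ (H : Subgroup G) (γ : TwistedCentre.Cochain₂ H k) (hγ : γ.d = α.restrict H),
      Nonempty (L ≅ TwistedCentre.lagrangianAlgebra α H γ hγ) := by
  have := hL.comm
  obtain ⟨t, ht⟩ := L.X.exists_isDegreeOneChar fun h =>
    hL.nonzero (TwistedCentre.Obj.isZero_of_unitElt_eq_zero h)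
  -- The same instance as in `lagrangianAlgebra`, so that the target of `toTransfer` is literally
  -- the algebra of the statement.
  let : Fintype ht.support := Fintype.ofFinite _
  refine ⟨ht.support, ht.cochain, ht.cochain_d, ⟨?_⟩⟩
  let φ := TwistedCentre.Obj.isoOfBijective ht.toTransfer (ht.toTransfer_bijective hL)
  have : CategoryTheory.IsMonHom φ.hom := ht.toTransfer_isMonHom
  exact CategoryTheory.Mon.mkIso' φ
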